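/- Let $\mathbb{R}_n$ be the real Clifford algebra over $n$ imaginary units $e_1,\dots,e_n$ ($e_i^2=-1$, $e_ie_j=-e_je_i$ for $i\neq j$) with the Euclidean norm $\|\sum_A y_Ae_A\|^2=\sum_A y_A^2$. A function $f:\mathbb{R}^{n+1}\to\mathbb{R}_n$ is entire left monogenic if it is $C^1$ and $\partial_{x_0}f+\sum_{i=1}^n e_i\partial_{x_i}f\equiv 0$. A proximate order for the order $\rho>0$ is a differentiable function $\hat\rho:[0,\infty)\to[0,\infty)$ with $\hat\rho(r)\to\rho$ and $\hat\rho'(r)\,r\ln r\to 0$ as $r\to+\infty$; it is normalized if $r\mapsto r^{\hat\rho(r)}$ is a strictly increasing map of $(0,\infty)$ onto $(0,\infty)$. In that case let $\varphi$ be the inverse of this map and put $G_{\hat\rho,q}=\varphi(q)^q/(e\rho)^{q/\rho}$ for $q\in\mathbb{N}_0$ (so $G_{\hat\rho,0}=1$). For $\sigma>0$ let $A_{\hat\rho,\sigma}$ be the space of entire left monogenic $f$ with $$\|f\|_{\hat\rho,\sigma}=\sup_{x\in\mathbb{R}^{n+1}}\|f(x)\|\exp\bigl(-\sigma\|x\|^{\hat\rho(\|x\|)}\bigr)<\infty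 .$$ For $m=(m_1,\dots,m_n)\in\mathbb{N}_0^n$ let $|m|=\sum_i m_i$, $m!=\prod_i m_i!$, $\partial^m=\partial_{x_1}^{m_1}\cdots\partial_{x_n}^{m_n}$ and $c(n,m)=\dfrac{n(n+1)\cdots(n+|m|-1)}{m!}$. Lemma. For every $\rho>0$ there is a constant $k>0$ depending only on $\rho$ with the following property. For every normalized proximate order $\hat\rho$ for the order $\rho$ and every $\sigma>0$ there is a constant $C(\sigma)>0$ (depending only on $\hat\rho$ and $\sigma$) such that for every $n$, every $f\in A_{\hat\rho,\sigma}$ and every multi-index $m\in\mathbb{N}_0^n$, with $q=|m|$, one has $\partial^m f\in A_{\hat\rho,k\sigma}$ and $$\frac1{m!}\,\|\partial^m f\|_{\hat\rho,k\sigma}\le C(\sigma)\,\|f\|_{\hat\rho,\sigma}\,\frac{\bigl(2k\,c(n,m)^{\rho/q}\,\sigma\bigr)^{q/\rho}}{G_{\hat\rho,q}},$$ where for $q=0$ the last fraction is read as $1$. -/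

import Mathlib

open Filter Topology Set
open scoped symmDiff

noncomputable section

namespace Monogenic

/-! ### The real Clifford algebra `ℝ_n` and its Euclidean norm -/

/-- The quadratic form `v ↦ -(v₁² + ⋯ + v_n²)` on `ℝⁿ`. -/
def negForm (n : ℕ) : QuadraticForm ℝ (Fin n → ℝ) :=
  QuadraticMap.weightedSumSquares ℝ (fun _ : Fin n => (-1 : ℝ))

/-- The real Clifford algebra over `n` imaginary units (`e_i² = -1`, `e_i e_j + e_j e_i = 0`). -/
abbrev Cl (n : ℕ) : Type := CliffordAlgebra (negForm n)

/-- The imaginary unit `e_i`. -/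
def e {n : ℕ} (i : Fin n) : Cl n := CliffordAlgebra.ι (negForm n) (Pi.single i 1)

/-- `e_A = e_{i₁} ⋯ e_{i_r}` for `A = {i₁ < ⋯ < i_r}`, with `e_∅ = 1`. -/
def eSet {n : ℕ} (A : Finset (Fin n)) : Cl n := ((A.sort (· ≤ ·)).map e).prod

theorem e_mul_self {n : ℕ} (i : Fin n) : (e i : Cl n) * e i = -1 := by
  unfold e
  rw [CliffordAlgebra.ι_sq_scalar]
  have : negForm n (Pi.single i 1) = -1 := by
    simp [negForm, QuadraticMap.weightedSumSquares_apply, Pi.single_apply]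
  rw [this, map_neg, map_one]

theorem e_mul_e {n : ℕ} {i j : Fin n} (h : i ≠ j) : (e i : Cl n) * e j = -(e j * e i) := by
  unfold e
  rw [eq_neg_iff_add_eq_zero, CliffordAlgebra.ι_mul_ι_add_swap]
  have : QuadraticMap.polar (negForm n) (Pi.single i 1) (Pi.single j 1) = 0 := by
    simp only [QuadraticMap.polar, negForm, QuadraticMap.weightedSumSquares_apply,
      ← Finset.sum_sub_distrib]
    refine Finset.sum_eq_zero fun x _ => ?_
    by_cases h1 : x = i
    · subst h1; simp [h]
    · simp [h1]
  rw [this, map_zero]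

theorem eSet_empty {n : ℕ} : eSet (∅ : Finset (Fin n)) = 1 := by simp [eSet]

theorem eSet_insert {n : ℕ} (a : Fin n) (A : Finset (Fin n)) (h : ∀ b ∈ A, a < b) :
    eSet (insert a A) = e a * eSet A := by
  unfold eSet
  rw [Finset.sort_insert _ (fun b hb => (h b hb).le) (fun ha => lt_irrefl _ (h a ha))]
  simp

theorem e_mul_eSet {n : ℕ} (A : Finset (Fin n)) :
    ∀ i : Fin n, ∃ c : ℝ, e i * eSet A = c • eSet (A ∆ {i}) := by
  induction A using Finset.induction_on_min with
  | empty => exact fun i => ⟨1, by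
      rw [one_smul, ← Finset.bot_eq_empty, bot_symmDiff, Finset.bot_eq_empty]
      exact (eSet_insert i ∅ (by simp)).symm⟩
  | insert a A ha ih =>
    intro i
    have haA : a ∉ A := fun h => lt_irrefl _ (ha a h)
    rcases lt_trichotomy i a with hi | rfl | hi
    · refine ⟨1, ?_⟩
      have h : ∀ b ∈ insert a A, i < b := by
        intro b hb
        rcases Finset.mem_insert.1 hb with rfl | hb
        · exact hi
        · exact hi.trans (ha b hb)
      have hn : i ∉ insert a A := fun hh => lt_irrefl _ (h i hh)
      rw [← eSet_insert i _ h, one_smul]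
      congr 1
      ext x
      simp only [Finset.mem_insert, Finset.mem_symmDiff, Finset.mem_singleton] at hn ⊢
      grind
    · refine ⟨-1, ?_⟩
      rw [eSet_insert i A ha, ← mul_assoc, e_mul_self, neg_one_mul, neg_one_smul]
      congr 2
      ext x
      simp only [Finset.mem_insert, Finset.mem_symmDiff, Finset.mem_singleton]
      grind
    · obtain ⟨c, hc⟩ := ih i
      refine ⟨-c, ?_⟩
      have h : ∀ b ∈ A ∆ {i}, a < b := by
        intro b hb
        simp only [Finset.mem_symmDiff, Finset.mem_singleton] at hb
        grind
      have hset : insert a A ∆ {i} = insert a (A ∆ {i}) := by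
        ext x
        simp only [Finset.mem_insert, Finset.mem_symmDiff, Finset.mem_singleton]
        grind
      rw [eSet_insert a A ha, ← mul_assoc, e_mul_e hi.ne', neg_mul, mul_assoc, hc, hset,
        eSet_insert a _ h, mul_smul_comm, neg_smul]

theorem ι_eq_sum {n : ℕ} (v : Fin n → ℝ) :
    CliffordAlgebra.ι (negForm n) v = ∑ i, v i • e i := by
  conv_lhs => rw [pi_eq_sum_univ' v]
  simp only [map_sum, map_smul, e]

theorem span_eSet (n : ℕ) : ⊤ ≤ Submodule.span ℝ (Set.range (eSet : Finset (Fin n) → Cl n)) := by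
  set S := Submodule.span ℝ (Set.range (eSet : Finset (Fin n) → Cl n))
  have key : ∀ y : Cl n, ∀ s ∈ S, y * s ∈ S := by
    intro y
    induction y using CliffordAlgebra.induction with
    | algebraMap r =>
      intro s hs
      rw [← Algebra.smul_def]
      exact S.smul_mem r hs
    | ι v =>
      intro s hs
      rw [ι_eq_sum, Finset.sum_mul]
      refine S.sum_mem fun i _ => ?_
      rw [smul_mul_assoc]
      refine S.smul_mem _ ?_
      induction hs using Submodule.span_induction with
      | mem x hx =>
        obtain ⟨A, rfl⟩ := hx
        obtain ⟨c, hc⟩ := e_mul_eSet A i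
        rw [hc]
        exact S.smul_mem _ (Submodule.subset_span ⟨_, rfl⟩)
      | zero => simp
      | add x y _ _ hx hy => rw [mul_add]; exact S.add_mem hx hy
      | smul a x _ hx => rw [mul_smul_comm]; exact S.smul_mem _ hx
    | mul a b ha hb => intro s hs; rw [mul_assoc]; exact ha _ (hb _ hs)
    | add a b ha hb => intro s hs; rw [add_mul]; exact S.add_mem (ha _ hs) (hb _ hs)
  intro y _
  have h1 : (1 : Cl n) ∈ S := Submodule.subset_span ⟨∅, eSet_empty⟩
  simpa using key y 1 h1

/-- The sign in `e_i e_A = ± e_{A ∆ {i}}`. -/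
def sgn {n : ℕ} (i : Fin n) (A : Finset (Fin n)) : ℝ := (-1) ^ (A.filter (· ≤ i)).card

/-- Left multiplication by `e_i` in coordinates. -/
def leftMul {n : ℕ} (i : Fin n) : Module.End ℝ (Finset (Fin n) → ℝ) where
  toFun y B := sgn i (B ∆ {i}) * y (B ∆ {i})
  map_add' x y := by ext B; simp [mul_add]
  map_smul' c y := by ext B; simp; ring

theorem sgn_symmDiff {n : ℕ} (i j : Fin n) (A : Finset (Fin n)) :
    sgn i (A ∆ {j}) = if j ≤ i then -sgn i A else sgn i A := by
  unfold sgn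
  by_cases hj : j ∈ A
  · have h1 : A ∆ {j} = A.erase j := by
      ext x; simp only [Finset.mem_symmDiff, Finset.mem_singleton, Finset.mem_erase]; grind
    rw [h1, Finset.filter_erase]
    split_ifs with h
    · have hm : j ∈ A.filter (· ≤ i) := by simp [hj, h]
      rw [← Finset.card_erase_add_one hm, pow_succ]; ring
    · rw [Finset.erase_eq_of_notMem (by simp [h])]
  · have h1 : A ∆ {j} = insert j A := by
      ext x; simp only [Finset.mem_symmDiff, Finset.mem_singleton, Finset.mem_insert]; grind
    rw [h1, Finset.filter_insert]
    split_ifs with h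
    · rw [Finset.card_insert_of_notMem (by simp [hj]), pow_succ]; ring
    · rfl

theorem sgn_mul_self {n : ℕ} (i : Fin n) (A : Finset (Fin n)) : sgn i A * sgn i A = 1 := by
  unfold sgn
  rw [← mul_pow]; simp

theorem leftMul_anticomm {n : ℕ} (i j : Fin n) (y : Finset (Fin n) → ℝ) :
    leftMul i (leftMul j y) + leftMul j (leftMul i y) = if i = j then (-2 : ℝ) • y else 0 := by
  ext B
  have hc : B ∆ {j} ∆ {i} = B ∆ {i} ∆ {j} := symmDiff_right_comm _ _ _
  simp only [leftMul, LinearMap.coe_mk, AddHom.coe_mk, Pi.add_apply, hc]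
  rcases lt_trichotomy i j with h | rfl | h
  · rw [if_neg h.ne]
    simp only [sgn_symmDiff, h.le, not_le.2 h, le_refl, if_true, if_false, Pi.zero_apply]
    ring
  · have hB : B ∆ {i} ∆ {i} = B := by rw [symmDiff_assoc, symmDiff_self]; simp
    have := sgn_mul_self i B
    simp only [hB, sgn_symmDiff i i B, le_refl, if_true, Pi.smul_apply, smul_eq_mul]
    linear_combination (-2 * y B) * this
  · rw [if_neg h.ne']
    simp only [sgn_symmDiff, h.le, not_le.2 h, le_refl, if_true, if_false, Pi.zero_apply]
    ring

/-- The left regular representation of `ℝ_n` in coordinates. -/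
def rep (n : ℕ) : Cl n →ₐ[ℝ] Module.End ℝ (Finset (Fin n) → ℝ) :=
  CliffordAlgebra.lift (negForm n)
    ⟨∑ i, (LinearMap.proj i : (Fin n → ℝ) →ₗ[ℝ] ℝ).smulRight (leftMul i), by
      intro v
      refine LinearMap.ext fun y => ?_
      simp only [LinearMap.sum_apply, LinearMap.smulRight_apply, LinearMap.proj_apply,
        Module.End.mul_apply, LinearMap.smul_apply, map_sum, map_smul, Module.algebraMap_end_apply]
      set T := ∑ i, v i • ∑ j, v j • leftMul j (leftMul i y) with hT
      have h2 : T + T = ((2 : ℝ) * negForm n v) • y := by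
        have e2 : T = ∑ i, ∑ j, (v i * v j) • leftMul j (leftMul i y) := by
          simp only [hT, Finset.smul_sum, smul_smul]
        have e3 : T = ∑ i, ∑ j, (v i * v j) • leftMul i (leftMul j y) := by
          rw [e2, Finset.sum_comm]
          simp only [mul_comm]
        conv_lhs => rw [e2]; arg 2; rw [← e2, e3]
        simp only [← Finset.sum_add_distrib, ← smul_add, leftMul_anticomm]
        simp only [smul_ite, smul_zero, Finset.sum_ite_eq', Finset.mem_univ, if_true, smul_smul,
          ← Finset.sum_smul]
        congr 1
        simp only [negForm, QuadraticMap.weightedSumSquares_apply, Finset.mul_sum, smul_eq_mul]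
        exact Finset.sum_congr rfl fun i _ => by ring
      rw [mul_smul, two_smul, ← two_smul ℝ, ← two_smul ℝ] at h2
      have h3 := smul_right_injective _ (two_ne_zero (α := ℝ)) h2
      rw [← h3, hT]⟩

theorem rep_e {n : ℕ} (i : Fin n) : rep n (e i) = leftMul i := by
  unfold rep e
  rw [CliffordAlgebra.lift_ι_apply]
  simp [LinearMap.sum_apply, Pi.single_apply]

theorem rep_eSet {n : ℕ} (A : Finset (Fin n)) :
    rep n (eSet A) (Pi.single ∅ 1) = Pi.single A 1 := by
  induction A using Finset.induction_on_min with
  | empty => simp [eSet_empty]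
  | insert a A ha ih =>
    have haA : a ∉ A := fun h => lt_irrefl _ (ha a h)
    rw [eSet_insert a A ha, map_mul, Module.End.mul_apply, ih, rep_e]
    ext B
    simp only [leftMul, LinearMap.coe_mk, AddHom.coe_mk, Pi.single_apply]
    have hiff : B ∆ {a} = A ↔ B = insert a A := by
      constructor
      · rintro rfl
        ext x
        simp only [Finset.mem_symmDiff, Finset.mem_singleton, Finset.mem_insert] at haA ⊢
        grind
      · rintro rfl
        ext x
        simp only [Finset.mem_symmDiff, Finset.mem_singleton, Finset.mem_insert]
        grind
    by_cases hB : B ∆ {a} = A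
    · rw [if_pos hB, if_pos (hiff.1 hB), hB]
      have : A.filter (· ≤ a) = ∅ := by
        ext x
        simp only [Finset.mem_filter, Finset.notMem_empty, iff_false, not_and, not_le]
        exact ha x
      simp [sgn, this]
    · rw [if_neg hB, if_neg (fun h => hB (hiff.2 h))]
      simp

theorem linearIndependent_eSet (n : ℕ) :
    LinearIndependent ℝ (eSet : Finset (Fin n) → Cl n) := by
  let T : Cl n →ₗ[ℝ] (Finset (Fin n) → ℝ) :=
    (LinearMap.applyₗ (Pi.single ∅ 1)).comp (rep n).toLinearMap
  refine LinearIndependent.of_comp T ?_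
  have : T ∘ eSet = fun A : Finset (Fin n) => Pi.single A (1 : ℝ) := by
    funext A
    exact rep_eSet A
  rw [this]
  exact Pi.linearIndependent_single_one _ _

/-- The basis `(e_A)` of `ℝ_n`, indexed by the subsets `A` of the index set. -/
def eBasis (n : ℕ) : Module.Basis (Finset (Fin n)) ℝ (Cl n) :=
  Module.Basis.mk (linearIndependent_eSet n) (span_eSet n)

/-- The coordinates `(y_A)` of `y = ∑_A y_A e_A`, as a Euclidean vector. -/
def coords (n : ℕ) : Cl n →ₗ[ℝ] EuclideanSpace ℝ (Finset (Fin n)) :=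
  (WithLp.linearEquiv 2 ℝ (Finset (Fin n) → ℝ)).symm.toLinearMap.comp
    (eBasis n).equivFun.toLinearMap

theorem coords_injective (n : ℕ) : Function.Injective (coords n) :=
  (WithLp.linearEquiv 2 ℝ (Finset (Fin n) → ℝ)).symm.injective.comp (eBasis n).equivFun.injective

/-- The Euclidean norm on `ℝ_n`. -/
instance instNormedAddCommGroupCl (n : ℕ) : NormedAddCommGroup (Cl n) :=
  NormedAddCommGroup.induced (Cl n) (EuclideanSpace ℝ (Finset (Fin n))) (coords n)
    (coords_injective n)

instance instNormedSpaceCl (n : ℕ) : NormedSpace ℝ (Cl n) :=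
  NormedSpace.induced ℝ (Cl n) (EuclideanSpace ℝ (Finset (Fin n))) (coords n)

theorem norm_sq_eq {n : ℕ} (y : Cl n) : ‖y‖ ^ 2 = ∑ A, ((eBasis n).repr y A) ^ 2 := by
  change ‖coords n y‖ ^ 2 = _
  rw [EuclideanSpace.norm_sq_eq]
  simp [coords]

/-! ### Monogenic functions -/

/-- `ℝ^{n+1}` with the Euclidean norm; the coordinates are `x_0, …, x_n`. -/
abbrev Pt (n : ℕ) : Type := EuclideanSpace ℝ (Fin (n + 1))

/-- The partial derivative `∂_{x_j}`, for `j = 0, …, n`. -/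
def pderiv {n : ℕ} (j : Fin (n + 1)) (f : Pt n → Cl n) : Pt n → Cl n :=
  fun x => fderiv ℝ f x (EuclideanSpace.single j 1)

/-- The operator `𝒟 = ∂_{x_0} + ∑_{i=1}^n e_i ∂_{x_i}`. -/
def dirac {n : ℕ} (f : Pt n → Cl n) : Pt n → Cl n :=
  fun x => pderiv 0 f x + ∑ i : Fin n, e i * pderiv i.succ f x

/-- Entire left monogenic functions. -/
def IsMonogenic {n : ℕ} (f : Pt n → Cl n) : Prop :=
  ContDiff ℝ 1 f ∧ ∀ x, dirac f x = 0

/-- `∂^m f = ∂_{x_1}^{m_1} ⋯ ∂_{x_n}^{m_n} f` (the variable `x_0` does not occur). -/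
def mderiv {n : ℕ} (m : Fin n → ℕ) (f : Pt n → Cl n) : Pt n → Cl n :=
  (List.finRange n).foldr (fun i g => (pderiv i.succ)^[m i] g) f

/-- `|m| = m_1 + ⋯ + m_n`. -/
def mdeg {n : ℕ} (m : Fin n → ℕ) : ℕ := ∑ i, m i

/-- `m! = m_1! ⋯ m_n!`. -/
def mfact {n : ℕ} (m : Fin n → ℕ) : ℕ := ∏ i, (m i).factorial

/-- `c(n, m) = n (n + 1) ⋯ (n + |m| - 1) / m!`. -/
def cauchyConst (n : ℕ) (m : Fin n → ℕ) : ℝ :=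
  (∏ j ∈ Finset.range (mdeg m), ((n : ℝ) + j)) / mfact m

/-! ### Proximate orders -/

/-- `p` is a proximate order for the order `ρ`; only the values `p r` with `r ≥ 0` matter. -/
structure IsProximateOrder (p : ℝ → ℝ) (ρ : ℝ) : Prop where
  nonneg : ∀ r, 0 ≤ r → 0 ≤ p r
  differentiableOn : DifferentiableOn ℝ p (Ici 0)
  tendsto : Tendsto p atTop (𝓝 ρ)
  tendsto_deriv : Tendsto (fun r => deriv p r * r * Real.log r) atTop (𝓝 0)

/-- `p` is a normalized proximate order for the order `ρ`: moreover `r ↦ r ^ p(r)` is a strictly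
increasing map of `(0, ∞)` onto `(0, ∞)`. -/
structure IsNormalizedProximateOrder (p : ℝ → ℝ) (ρ : ℝ) : Prop
    extends IsProximateOrder p ρ where
  strictMonoOn : StrictMonoOn (fun r => r ^ p r) (Ioi 0)
  bijOn : BijOn (fun r => r ^ p r) (Ioi 0) (Ioi 0)

/-- The inverse function `φ : (0, ∞) → (0, ∞)` of `r ↦ r ^ p(r)`. -/
def phi (p : ℝ → ℝ) : ℝ → ℝ := Function.invFunOn (fun r => r ^ p r) (Ioi 0)

/-- `G_{p,q} = φ(q)^q / (e ρ)^{q/ρ}`; in particular `G_{p,0} = 1`. -/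
def G (p : ℝ → ℝ) (ρ : ℝ) (q : ℕ) : ℝ :=
  phi p q ^ q / (Real.exp 1 * ρ) ^ ((q : ℝ) / ρ)

/-- The function `x ↦ ‖f(x)‖ exp(-σ ‖x‖ ^ p(‖x‖))`. -/
def weighted {n : ℕ} (p : ℝ → ℝ) (σ : ℝ) (f : Pt n → Cl n) (x : Pt n) : ℝ :=
  ‖f x‖ * Real.exp (-σ * ‖x‖ ^ p ‖x‖)

/-- The norm `‖f‖_{p,σ}`, meaningful when the supremum is finite. -/
def wnorm {n : ℕ} (p : ℝ → ℝ) (σ : ℝ) (f : Pt n → Cl n) : ℝ := ⨆ x, weighted p σ f x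

/-- The space `A_{p,σ}`. -/
def growthSpace (n : ℕ) (p : ℝ → ℝ) (σ : ℝ) : Set (Pt n → Cl n) :=
  {f | IsMonogenic f ∧ BddAbove (range (weighted p σ f))}

end Monogenic

end

noncomputable section

namespace Monogenic

/-! ### Second partial derivatives and the weak maximum principle -/

/-! A monogenic function is harmonic, so its derivatives at `x` are controlled by its size on a
sphere of radius `r` about `x`. The constant `C(σ)` may not depend on `n`, so the Cauchy estimate
must carry the right dimensional factor: for `q` derivatives it may cost at most a fixed constant to
the power `q` times `n(n+1)⋯(n+q-1)`, which after division by `m!` becomes `c(n,m)`.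

This estimate comes from Bernstein's method instead of an integral formula. To `u²` one adds, for
each order `j ≤ q`, a small multiple of the square of `(r² - ‖x-c‖²)^j` times the `j`-th iterated
partial derivative of `u`. With suitable weights the sum is subharmonic; it equals `u²` on the
sphere and dominates the last square at the centre, so the maximum principle bounds that derivative
(`exists_bernstein`, `norm_iterPartial_le`, `sqrt_bernsteinConst_le`). As monogenic functions are
only assumed `C¹`, mollification and the same estimate for one derivative first show that they are
smooth (`IsMonogenic.pderiv`, `IsMonogenic.contDiff`).

On the growth side, `t ^ p t` behaves like a power of order `ρ` under dilation
(`IsProximateOrder.tendsto_ratio`), so it is subadditive up to the factor `2^(ρ+1)` and an additive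
constant. Hence on the sphere `f` is at most `‖f‖ exp(σ 2^(ρ+1)(‖x‖^p + r^p) + const)`; the weight
with `kσ` removes the `‖x‖` part. With `r = φ(q/σ)` the rest is a constant to the power `q`, and
`φ(q)` is eventually at most `2 σ^(1/ρ) φ(q/σ)`. All geometric factors are absorbed in `k`, which
depends on `ρ` alone; the additive constant and the finitely many small `q` go into `C(σ)`. -/

theorem second_deriv_nonpos_of_isLocalMax {φ φ' : ℝ → ℝ} {c : ℝ}
    (h1 : ∀ t, HasDerivAt φ (φ' t) t) (h2 : HasDerivAt φ' c 0) (hmax : IsLocalMax φ 0) :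
    c ≤ 0 := by
  by_contra! hc
  have hd : deriv φ = φ' := funext fun t => (h1 t).deriv
  have h0 : deriv φ 0 = 0 := hmax.deriv_eq_zero
  -- A positive second derivative makes the critical point a local minimum too, so `φ` is locally
  -- constant and `c = 0`, a contradiction.
  have hmin : IsLocalMin φ 0 := by
    refine isLocalMin_of_deriv_deriv_pos ?_ h0 (h1 0).continuousAt
    rw [hd, h2.deriv]; exact hc
  have hconst : ∀ᶠ t in 𝓝 (0 : ℝ), φ t = φ 0 := by
    filter_upwards [hmax, hmin] with t ht1 ht2 using le_antisymm ht1 ht2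
  have hder : φ' =ᶠ[𝓝 0] fun _ => (0 : ℝ) := by
    filter_upwards [hconst.eventually_nhds] with t ht
    rw [← (h1 t).deriv]
    have : φ =ᶠ[𝓝 t] fun _ => φ 0 := ht
    rw [this.deriv_eq, deriv_const]
  have : c = 0 := by
    rw [← h2.deriv, hder.deriv_eq, deriv_const]
  exact hc.ne' this

/-- `g j` and `h j` are the first and second partial derivatives of `u` in the direction `j`. -/
structure HasSecondPartials {N : ℕ} (u : EuclideanSpace ℝ (Fin N) → ℝ)
    (g h : Fin N → EuclideanSpace ℝ (Fin N) → ℝ) : Prop where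
  fst : ∀ j x, HasLineDerivAt ℝ u (g j x) x (EuclideanSpace.single j 1)
  snd : ∀ j x, HasLineDerivAt ℝ (g j) (h j x) x (EuclideanSpace.single j 1)

theorem hasLineDerivAt_mul {E : Type*} [NormedAddCommGroup E] [NormedSpace ℝ E] {u v : E → ℝ}
    {a b : ℝ} {x w : E} (hu : HasLineDerivAt ℝ u a x w) (hv : HasLineDerivAt ℝ v b x w) :
    HasLineDerivAt ℝ (fun y => u y * v y) (a * v x + u x * b) x w := by
  have h := HasDerivAt.mul hu hv
  simp only [zero_smul, add_zero] at h
  exact h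

theorem hasLineDerivAt_add {E : Type*} [NormedAddCommGroup E] [NormedSpace ℝ E] {u v : E → ℝ}
    {a b : ℝ} {x w : E} (hu : HasLineDerivAt ℝ u a x w) (hv : HasLineDerivAt ℝ v b x w) :
    HasLineDerivAt ℝ (fun y => u y + v y) (a + b) x w :=
  HasDerivAt.add hu hv

namespace HasSecondPartials

variable {N : ℕ} {u v : EuclideanSpace ℝ (Fin N) → ℝ}
  {g h g' h' : Fin N → EuclideanSpace ℝ (Fin N) → ℝ}

theorem mul (hu : HasSecondPartials u g h) (hv : HasSecondPartials v g' h') :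
    HasSecondPartials (fun x => u x * v x) (fun j x => g j x * v x + u x * g' j x)
      (fun j x => h j x * v x + 2 * (g j x * g' j x) + u x * h' j x) where
  fst j x := hasLineDerivAt_mul (hu.fst j x) (hv.fst j x)
  snd j x := by
    have h1 := hasLineDerivAt_add (hasLineDerivAt_mul (hu.snd j x) (hv.fst j x))
      (hasLineDerivAt_mul (hu.fst j x) (hv.snd j x))
    have e : h j x * v x + 2 * (g j x * g' j x) + u x * h' j x
      = h j x * v x + g j x * g' j x + (g j x * g' j x + u x * h' j x) := by ring
    rw [e]
    exact h1

theorem add (hu : HasSecondPartials u g h) (hv : HasSecondPartials v g' h') :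
    HasSecondPartials (fun x => u x + v x) (fun j x => g j x + g' j x)
      (fun j x => h j x + h' j x) where
  fst j x := hasLineDerivAt_add (hu.fst j x) (hv.fst j x)
  snd j x := hasLineDerivAt_add (hu.snd j x) (hv.snd j x)

theorem const (c : ℝ) : HasSecondPartials (fun _ : EuclideanSpace ℝ (Fin N) => c)
    (fun _ _ => 0) (fun _ _ => 0) where
  fst _ _ := hasDerivAt_const _ _
  snd _ _ := hasDerivAt_const _ _

theorem const_mul (c : ℝ) (hu : HasSecondPartials u g h) :
    HasSecondPartials (fun x => c * u x) (fun j x => c * g j x) (fun j x => c * h j x) := by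
  simpa using (const c).mul hu

/-- The truncated exponent `k - 1` is harmless at `k = 0`, where its coefficient vanishes. -/
theorem pow_succ (hu : HasSecondPartials u g h) (k : ℕ) :
    HasSecondPartials (fun x => u x ^ (k + 1)) (fun j x => (k + 1) * u x ^ k * g j x)
      (fun j x => (k + 1) * (k * u x ^ (k - 1) * g j x ^ 2 + u x ^ k * h j x)) := by
  induction k with
  | zero => simpa using hu
  | succ k ih =>
    convert ih.mul hu using 3
    · ring
    · push_cast; ring
    · rcases k with _ | k
      · simp; ring
      · simp only [Nat.add_sub_cancel]; push_cast; ring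

/-- The function `x ↦ ‖x - c‖²`. -/
theorem norm_sub_sq (c : EuclideanSpace ℝ (Fin N)) :
    HasSecondPartials (fun x => ‖x - c‖ ^ 2) (fun j x => 2 * (x j - c j)) (fun _ _ => 2) where
  fst j x := by
    have h1 : HasDerivAt (fun t : ℝ => ‖x - c‖ ^ 2 + 2 * t * (x j - c j) + t ^ 2)
        (2 * (x j - c j)) 0 := by
      have := ((((hasDerivAt_id (0 : ℝ)).const_mul 2).mul_const (x j - c j)).const_add
        (‖x - c‖ ^ 2)).add ((hasDerivAt_id (0 : ℝ)).pow 2)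
      simp only [id_eq, mul_one, Nat.cast_ofNat, pow_one, mul_zero, add_zero,
        Nat.add_one_sub_one] at this
      exact this
    refine h1.congr_of_eventuallyEq (Eventually.of_forall fun t => ?_)
    have e1 : x + t • EuclideanSpace.single j (1 : ℝ) - c
        = (x - c) + t • EuclideanSpace.single j (1 : ℝ) := by abel
    simp only [e1]
    rw [norm_add_sq_real, inner_smul_right, norm_smul]
    simp [EuclideanSpace.inner_single_right]
    ring
  snd j x := by
    have h1 : HasDerivAt (fun t : ℝ => 2 * (x j + t - c j)) 2 0 := by
      simpa using ((((hasDerivAt_id (0 : ℝ)).const_add (x j)).sub_const (c j)).const_mul 2)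
    refine h1.congr_of_eventuallyEq (Eventually.of_forall fun t => ?_)
    simp

theorem second_nonpos_of_isLocalMax (hu : HasSecondPartials u g h)
    {x : EuclideanSpace ℝ (Fin N)} (hmax : IsLocalMax u x) (j : Fin N) : h j x ≤ 0 := by
  have hcont : ContinuousAt (fun t : ℝ => x + t • EuclideanSpace.single j (1 : ℝ)) 0 := by
    fun_prop
  refine second_deriv_nonpos_of_isLocalMax
    (φ := fun t => u (x + t • EuclideanSpace.single j (1 : ℝ)))
    (φ' := fun t => g j (x + t • EuclideanSpace.single j (1 : ℝ))) (fun t => ?_) (hu.snd j x) ?_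
  · have h1 : HasDerivAt (fun s => u (x + t • EuclideanSpace.single j (1 : ℝ)
        + s • EuclideanSpace.single j (1 : ℝ)))
        (g j (x + t • EuclideanSpace.single j (1 : ℝ))) (t - t) := by
      rw [sub_self]
      exact hu.fst j (x + t • EuclideanSpace.single j (1 : ℝ))
    have h2 := h1.comp_sub_const t t
    refine h2.congr_of_eventuallyEq (Eventually.of_forall fun s => ?_)
    simp only [add_assoc, ← add_smul]
    congr 3
    ring
  · have : Tendsto (fun t : ℝ => x + t • EuclideanSpace.single j (1 : ℝ)) (𝓝 0) (𝓝 x) := by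
      simpa [ContinuousAt] using hcont
    have h3 := this.eventually hmax
    filter_upwards [h3] with t ht
    simpa using ht

/-- The weak maximum principle on a ball. -/
theorem le_of_subharmonic (hu : HasSecondPartials u g h) (hN : 0 < N)
    (hcont : Continuous u) {c : EuclideanSpace ℝ (Fin N)} {r B : ℝ} (hr : 0 < r)
    (hsub : ∀ x ∈ Metric.ball c r, 0 ≤ ∑ j, h j x) (hB : ∀ x ∈ Metric.sphere c r, u x ≤ B) :
    u c ≤ B := by
  suffices H : ∀ ε > 0, u c ≤ B + ε * r ^ 2 by
    refine le_of_forall_pos_le_add fun δ hδ => ?_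
    have := H (δ / r ^ 2) (by positivity)
    rwa [div_mul_cancel₀ _ (by positivity)] at this
  intro ε hε
  -- The perturbation `ε‖x - c‖²` makes the Laplacian strictly positive, which excludes an interior
  -- maximum; on the sphere it costs only `ε r²`.
  have hw := hu.add ((norm_sub_sq c).const_mul ε)
  obtain ⟨x, hx, hxmax⟩ := (isCompact_closedBall c r).exists_isMaxOn
    (Metric.nonempty_closedBall.2 hr.le)
    (f := fun x => u x + ε * ‖x - c‖ ^ 2) (by fun_prop)
  have hc : u c ≤ u x + ε * ‖x - c‖ ^ 2 := by
    simpa using hxmax (Metric.mem_closedBall_self hr.le)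
  rcases (Metric.mem_closedBall.1 hx).lt_or_eq with hlt | heq
  · exfalso
    have hloc : IsLocalMax (fun x => u x + ε * ‖x - c‖ ^ 2) x :=
      hxmax.isLocalMax (Filter.mem_of_superset (Metric.isOpen_ball.mem_nhds hlt)
        Metric.ball_subset_closedBall)
    have h1 : ∑ j, (h j x + ε * 2) ≤ 0 :=
      Finset.sum_nonpos fun j _ => hw.second_nonpos_of_isLocalMax hloc j
    rw [Finset.sum_add_distrib] at h1
    have h2 := hsub x hlt
    simp at h1
    have : (0 : ℝ) < N := by exact_mod_cast hN
    nlinarith [mul_pos this hε]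
  · have h1 := hB x heq
    have h2 : ‖x - c‖ = r := by rw [← dist_eq_norm]; exact heq
    rw [h2] at hc
    linarith

end HasSecondPartials

/-! ### Iterated partial derivatives of smooth harmonic functions -/

/-- The partial derivative in the direction `j`. -/
def partialDeriv {N : ℕ} {F : Type*} [NormedAddCommGroup F] [NormedSpace ℝ F] (j : Fin N)
    (u : EuclideanSpace ℝ (Fin N) → F) : EuclideanSpace ℝ (Fin N) → F :=
  fun x => fderiv ℝ u x (EuclideanSpace.single j 1)

/-- The iterated partial derivative along a list of directions. -/
def iterPartial {N : ℕ} {F : Type*} [NormedAddCommGroup F] [NormedSpace ℝ F] (L : List (Fin N))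
    (u : EuclideanSpace ℝ (Fin N) → F) : EuclideanSpace ℝ (Fin N) → F :=
  L.foldr partialDeriv u

/-- Smooth harmonic functions on the whole space. -/
structure SmoothHarmonic {N : ℕ} {F : Type*} [NormedAddCommGroup F] [NormedSpace ℝ F]
    (u : EuclideanSpace ℝ (Fin N) → F) : Prop where
  contDiff : ∀ k : ℕ, ContDiff ℝ k u
  laplace : ∀ x, ∑ j, partialDeriv j (partialDeriv j u) x = 0

section PartialDeriv

variable {N : ℕ} {F F' : Type*} [NormedAddCommGroup F] [NormedSpace ℝ F]
  [NormedAddCommGroup F'] [NormedSpace ℝ F'] {u v : EuclideanSpace ℝ (Fin N) → F}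

theorem contDiff_partialDeriv {k : ℕ} (hu : ContDiff ℝ (k + 1 : ℕ) u) (j : Fin N) :
    ContDiff ℝ k (partialDeriv j u) :=
  (hu.fderiv_right (m := k) (by norm_cast)).clm_apply contDiff_const

theorem hasLineDerivAt_partialDeriv (hu : Differentiable ℝ u) (j : Fin N)
    (x : EuclideanSpace ℝ (Fin N)) :
    HasLineDerivAt ℝ u (partialDeriv j u x) x (EuclideanSpace.single j 1) :=
  (hu x).hasFDerivAt.hasLineDerivAt _

theorem partialDeriv_comm (hu : ContDiff ℝ 2 u) (i j : Fin N) :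
    partialDeriv i (partialDeriv j u) = partialDeriv j (partialDeriv i u) := by
  have hd : Differentiable ℝ (fderiv ℝ u) :=
    (hu.fderiv_right (m := 1) (by norm_num)).differentiable (by norm_num)
  have key : ∀ (i j : Fin N) x, partialDeriv i (partialDeriv j u) x
      = fderiv ℝ (fderiv ℝ u) x (EuclideanSpace.single i 1) (EuclideanSpace.single j 1) := by
    intro i j x
    unfold partialDeriv
    rw [fderiv_clm_apply (hd x) (differentiableAt_const _)]
    simp
  funext x
  rw [key, key]
  have hs : IsSymmSndFDerivAt ℝ u x := hu.contDiffAt.isSymmSndFDerivAt (by simp)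
  exact hs.eq _ _

theorem partialDeriv_clm_comp (ℓ : F →L[ℝ] F') (hu : Differentiable ℝ u) (j : Fin N) :
    partialDeriv j (fun x => ℓ (u x)) = fun x => ℓ (partialDeriv j u x) := by
  funext x
  have h : HasFDerivAt (fun y => ℓ (u y)) (ℓ ∘L fderiv ℝ u x) x :=
    ℓ.hasFDerivAt.comp x (hu x).hasFDerivAt
  simp only [partialDeriv, h.fderiv, ContinuousLinearMap.comp_apply]

theorem partialDeriv_sub (hu : Differentiable ℝ u) (hv : Differentiable ℝ v) (j : Fin N) :
    partialDeriv j (fun x => u x - v x) = fun x => partialDeriv j u x - partialDeriv j v x := by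
  funext x
  simp only [partialDeriv]
  rw [fderiv_fun_sub (hu x) (hv x)]
  rfl

theorem partialDeriv_sum {ι : Type*} (s : Finset ι) {w : ι → EuclideanSpace ℝ (Fin N) → F}
    (hw : ∀ i ∈ s, Differentiable ℝ (w i)) (j : Fin N) :
    partialDeriv j (fun x => ∑ i ∈ s, w i x) = fun x => ∑ i ∈ s, partialDeriv j (w i) x := by
  funext x
  simp only [partialDeriv]
  rw [fderiv_fun_sum fun i hi => hw i hi x]
  simp

theorem hasSecondPartials_of_contDiff {u : EuclideanSpace ℝ (Fin N) → ℝ} (hu : ContDiff ℝ 2 u) :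
    HasSecondPartials u (fun j => partialDeriv j u)
      (fun j => partialDeriv j (partialDeriv j u)) where
  fst j x := hasLineDerivAt_partialDeriv (hu.differentiable (by norm_num)) j x
  snd j x := hasLineDerivAt_partialDeriv
    ((contDiff_partialDeriv (k := 1) hu j).differentiable (by norm_num)) j x

end PartialDeriv

namespace SmoothHarmonic

variable {N : ℕ} {F F' : Type*} [NormedAddCommGroup F] [NormedSpace ℝ F]
  [NormedAddCommGroup F'] [NormedSpace ℝ F'] {u v : EuclideanSpace ℝ (Fin N) → F}

theorem differentiable (hu : SmoothHarmonic u) : Differentiable ℝ u :=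
  (hu.contDiff 1).differentiable (by norm_num)

theorem partialDeriv (hu : SmoothHarmonic u) (i : Fin N) :
    SmoothHarmonic (partialDeriv i u) where
  contDiff k := contDiff_partialDeriv (hu.contDiff (k + 1)) i
  laplace x := by
    have h2 : ∀ j, ContDiff ℝ 2 (Monogenic.partialDeriv j u) :=
      fun j => contDiff_partialDeriv (hu.contDiff 3) j
    have h3 : ∀ j, Differentiable ℝ (Monogenic.partialDeriv j (Monogenic.partialDeriv j u)) :=
      fun j => (contDiff_partialDeriv (k := 1) (h2 j) j).differentiable (by norm_num)
    have h1 : ∀ j, Monogenic.partialDeriv j (Monogenic.partialDeriv j (Monogenic.partialDeriv i u))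
        = Monogenic.partialDeriv i (Monogenic.partialDeriv j (Monogenic.partialDeriv j u)) := by
      intro j
      rw [partialDeriv_comm (hu.contDiff 2) j i, partialDeriv_comm (h2 j) j i]
    simp only [h1]
    have h4 := congrFun (partialDeriv_sum Finset.univ (fun j _ => h3 j) i) x
    rw [← h4]
    have h5 : (fun x => ∑ j, Monogenic.partialDeriv j (Monogenic.partialDeriv j u) x)
        = fun _ => 0 := funext hu.laplace
    rw [h5]
    simp [Monogenic.partialDeriv]

theorem iterPartial (hu : SmoothHarmonic u) (L : List (Fin N)) :
    SmoothHarmonic (iterPartial L u) := by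
  induction L with
  | nil => exact hu
  | cons j L ih => exact ih.partialDeriv j

theorem clm_comp (hu : SmoothHarmonic u) (ℓ : F →L[ℝ] F') :
    SmoothHarmonic (fun x => ℓ (u x)) where
  contDiff k := ℓ.contDiff.comp (hu.contDiff k)
  laplace x := by
    have h1 : ∀ j, Differentiable ℝ (Monogenic.partialDeriv j u) :=
      fun j => (hu.partialDeriv j).differentiable
    simp only [partialDeriv_clm_comp ℓ hu.differentiable, partialDeriv_clm_comp ℓ (h1 _)]
    rw [← map_sum, hu.laplace, map_zero]

theorem sub (hu : SmoothHarmonic u) (hv : SmoothHarmonic v) :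
    SmoothHarmonic (fun x => u x - v x) where
  contDiff k := (hu.contDiff k).sub (hv.contDiff k)
  laplace x := by
    simp only [partialDeriv_sub hu.differentiable hv.differentiable,
      partialDeriv_sub (hu.partialDeriv _).differentiable (hv.partialDeriv _).differentiable]
    rw [Finset.sum_sub_distrib, hu.laplace, hv.laplace, sub_zero]

end SmoothHarmonic

theorem iterPartial_clm_comp {N : ℕ} {F F' : Type*} [NormedAddCommGroup F] [NormedSpace ℝ F]
    [NormedAddCommGroup F'] [NormedSpace ℝ F'] {u : EuclideanSpace ℝ (Fin N) → F}
    (hu : SmoothHarmonic u) (ℓ : F →L[ℝ] F') (L : List (Fin N)) :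
    iterPartial L (fun x => ℓ (u x)) = fun x => ℓ (iterPartial L u x) := by
  induction L with
  | nil => rfl
  | cons j L ih =>
    change partialDeriv j (iterPartial L _) = fun x => ℓ (partialDeriv j (iterPartial L u) x)
    rw [ih, partialDeriv_clm_comp ℓ (hu.iterPartial L).differentiable]

/-! ### Cauchy estimates for harmonic functions by Bernstein's method -/

theorem HasSecondPartials.sq_sub_norm_sq {N : ℕ} (c : EuclideanSpace ℝ (Fin N)) (r : ℝ) :
    HasSecondPartials (fun x => r ^ 2 - ‖x - c‖ ^ 2) (fun j x => -2 * (x j - c j))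
      (fun _ _ => -2) := by
  have := (HasSecondPartials.const (N := N) (r ^ 2)).add
    ((HasSecondPartials.norm_sub_sq c).const_mul (-1))
  convert this using 3 <;> ring

/-- The right side is the second derivative of `(t^(q+1) w)²` in one direction, as the product rule
delivers it, for a `t` with second derivative `-2`. Completing the square in `wj` removes the mixed
term. The `w * wjj` term is kept because it sums to zero over the directions when `w` is harmonic.
-/
theorem bernstein_pointwise (q : ℕ) (t tj w wj wjj : ℝ) :
    t ^ (2 * (q + 1)) * wj ^ 2 - 16 * ((q : ℝ) + 1) ^ 2 * t ^ (2 * q) * tj ^ 2 * w ^ 2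
      - 4 * ((q : ℝ) + 1) * t ^ (2 * q + 1) * w ^ 2 + 2 * t ^ (2 * (q + 1)) * w * wjj ≤
    (((q : ℝ) + 1) * (q * t ^ (q - 1) * tj ^ 2 + t ^ q * -2) * w
        + 2 * ((((q : ℝ) + 1) * t ^ q * tj) * wj) + t ^ (q + 1) * wjj) * (t ^ (q + 1) * w)
      + 2 * ((((q : ℝ) + 1) * t ^ q * tj * w + t ^ (q + 1) * wj)
        * (((q : ℝ) + 1) * t ^ q * tj * w + t ^ (q + 1) * wj))
      + (t ^ (q + 1) * w) * (((q : ℝ) + 1) * (q * t ^ (q - 1) * tj ^ 2 + t ^ q * -2) * w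
        + 2 * ((((q : ℝ) + 1) * t ^ q * tj) * wj) + t ^ (q + 1) * wjj) := by
  have hq : (q : ℝ) * t ^ (q - 1) * t = q * t ^ q := by
    rcases q with _ | q
    · simp
    · simp [pow_succ, mul_assoc]
  have h1 : 0 ≤ (t ^ (q + 1) * wj + 4 * ((q : ℝ) + 1) * t ^ q * tj * w) ^ 2
      + 2 * ((q : ℝ) + 1) * (2 * q + 1) * (t ^ q * tj * w) ^ 2 := by positivity
  have e1 : t ^ (2 * q) = (t ^ q) ^ 2 := by ring
  have e2 : t ^ (2 * (q + 1)) = (t ^ q) ^ 2 * t ^ 2 := by ring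
  have e3 : t ^ (2 * q + 1) = (t ^ q) ^ 2 * t := by ring
  have e4 : t ^ (q + 1) = t ^ q * t := by ring
  rw [e1, e2, e3, e4]
  rw [e4] at h1
  refine le_of_sub_nonneg (h1.trans_eq ?_)
  linear_combination (-2 * ((q : ℝ) + 1) * t ^ q * tj ^ 2 * w ^ 2) * hq

/-- The product `∏_{i < q} 64 (i + 1) (N + i + 1) r²`. -/
def bernsteinConst (N : ℕ) (r : ℝ) (q : ℕ) : ℝ :=
  ∏ i ∈ Finset.range q, (64 * ((i : ℝ) + 1) * (N + i + 1) * r ^ 2)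

theorem bernsteinConst_pos (N : ℕ) {r : ℝ} (hr : 0 < r) (q : ℕ) : 0 < bernsteinConst N r q :=
  Finset.prod_pos fun i _ => by positivity

/-- Induction on the number of derivatives. The last conjunct is the fuel: adding the square of the
next derivative creates a negative term in the Laplacian, and the gradient term left over from the
previous order pays for it, while the new square leaves its own gradient term behind. The cutoff `r²
- ‖x - c‖²` vanishes on the sphere, so boundary values never change. -/
theorem exists_bernstein {N : ℕ} {u : EuclideanSpace ℝ (Fin N) → ℝ} (hu : SmoothHarmonic u)
    (c : EuclideanSpace ℝ (Fin N)) {r : ℝ} (hr : 0 < r) (L : List (Fin N)) :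
    ∃ (Φ : EuclideanSpace ℝ (Fin N) → ℝ) (G H : Fin N → EuclideanSpace ℝ (Fin N) → ℝ),
      HasSecondPartials Φ G H ∧ Continuous Φ ∧ (∀ x ∈ Metric.sphere c r, Φ x = u x ^ 2) ∧
      (bernsteinConst N r L.length)⁻¹ * (r ^ 2) ^ (2 * L.length) * iterPartial L u c ^ 2 ≤ Φ c ∧
      ∀ x ∈ Metric.ball c r, (bernsteinConst N r L.length)⁻¹ *
        (r ^ 2 - ‖x - c‖ ^ 2) ^ (2 * L.length) * ∑ j, partialDeriv j (iterPartial L u) x ^ 2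
          ≤ ∑ j, H j x := by
  induction L with
  | nil =>
    have h2 := hasSecondPartials_of_contDiff (hu.contDiff 2)
    refine ⟨_, _, _, h2.mul h2, ?_, ?_, ?_, ?_⟩
    · exact (hu.contDiff 0).continuous.mul (hu.contDiff 0).continuous
    · intro x _; ring
    · simp [bernsteinConst, iterPartial, sq]
    · intro x _
      simp only [Finset.sum_add_distrib, ← Finset.sum_mul, ← Finset.mul_sum, hu.laplace x]
      simp only [bernsteinConst, iterPartial, List.length_nil, Finset.range_zero, Finset.prod_empty,
        inv_one, mul_zero, pow_zero, List.foldr_nil, zero_mul, zero_add, add_zero, ← sq]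
      have : 0 ≤ ∑ j, partialDeriv j u x ^ 2 := Finset.sum_nonneg fun j _ => sq_nonneg _
      linarith
  | cons l L ih =>
    obtain ⟨Φ, G, H, hΦ, hcont, hsph, hcen, hsub⟩ := ih
    set q := L.length with hq
    set w := iterPartial (l :: L) u with hw
    have hwh : SmoothHarmonic w := hu.iterPartial (l :: L)
    set a := (bernsteinConst N r (q + 1))⁻¹ with ha
    have hapos : 0 < a := inv_pos.2 (bernsteinConst_pos N hr _)
    -- The weight `a` is chosen so that the negative term, at most `a * 64(q+1)(N+q+1) r² * t^(2q)
    -- w²`, is exactly what the previous order supplies.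
    have hstep : a * (64 * ((q : ℝ) + 1) * (N + q + 1) * r ^ 2) = (bernsteinConst N r q)⁻¹ := by
      have h1 : bernsteinConst N r (q + 1)
          = bernsteinConst N r q * (64 * ((q : ℝ) + 1) * (N + q + 1) * r ^ 2) :=
        Finset.prod_range_succ _ _
      have h2 := bernsteinConst_pos N hr q
      have h3 := bernsteinConst_pos N hr (q + 1)
      rw [ha, h1]
      have h4 : (0 : ℝ) < 64 * ((q : ℝ) + 1) * (N + q + 1) * r ^ 2 := by positivity
      field_simp
    have hP := ((HasSecondPartials.sq_sub_norm_sq c r).pow_succ q).mul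
      (hasSecondPartials_of_contDiff (hwh.contDiff 2))
    refine ⟨_, _, _, hΦ.add ((hP.mul hP).const_mul a), ?_, ?_, ?_, ?_⟩
    · have := (hwh.contDiff 0).continuous
      fun_prop
    · intro x hx
      have h1 : ‖x - c‖ = r := by rw [← dist_eq_norm]; exact hx
      simp [hsph x hx, h1]
    · have h0 : 0 ≤ Φ c := le_trans (by
        have := bernsteinConst_pos N hr q
        positivity) hcen
      simp only [List.length_cons, ← hq]
      rw [← ha]
      simp only [sub_self, norm_zero]
      have e : a * ((r ^ 2 - 0 ^ 2) ^ (q + 1) * w c * ((r ^ 2 - 0 ^ 2) ^ (q + 1) * w c))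
          = a * (r ^ 2) ^ (2 * (q + 1)) * w c ^ 2 := by ring
      rw [e]
      linarith
    · intro x hx
      have hxc : ‖x - c‖ < r := by rw [← dist_eq_norm]; exact hx
      set t := r ^ 2 - ‖x - c‖ ^ 2 with ht
      have ht0 : 0 ≤ t := by
        have := norm_nonneg (x - c)
        rw [ht]; nlinarith
      have htr : t ≤ r ^ 2 := by rw [ht]; linarith [sq_nonneg ‖x - c‖]
      simp only [List.length_cons, ← hq]
      rw [← ha]
      have h1 := hsub x hx
      have h2 : w x ^ 2 ≤ ∑ j, partialDeriv j (iterPartial L u) x ^ 2 :=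
        Finset.single_le_sum (f := fun j => partialDeriv j (iterPartial L u) x ^ 2)
          (fun j _ => sq_nonneg _) (Finset.mem_univ l)
      have h3 := Finset.sum_le_sum fun (j : Fin N) (_ : j ∈ Finset.univ) =>
        bernstein_pointwise q t (-2 * (x j - c j)) (w x) (partialDeriv j w x)
          (partialDeriv j (partialDeriv j w) x)
      have hnorm : ∑ j, (-2 * (x j - c j)) ^ 2 = 4 * ‖x - c‖ ^ 2 := by
        rw [EuclideanSpace.norm_sq_eq, Finset.mul_sum]
        refine Finset.sum_congr rfl fun j _ => ?_
        simp only [PiLp.sub_apply, Real.norm_eq_abs, sq_abs]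
        ring
      have hlhs : ∑ j, (t ^ (2 * (q + 1)) * partialDeriv j w x ^ 2
          - 16 * ((q : ℝ) + 1) ^ 2 * t ^ (2 * q) * (-2 * (x j - c j)) ^ 2 * w x ^ 2
          - 4 * ((q : ℝ) + 1) * t ^ (2 * q + 1) * w x ^ 2
          + 2 * t ^ (2 * (q + 1)) * w x * partialDeriv j (partialDeriv j w) x)
          = t ^ (2 * (q + 1)) * ∑ j, partialDeriv j w x ^ 2
          - 16 * ((q : ℝ) + 1) ^ 2 * t ^ (2 * q) * (4 * ‖x - c‖ ^ 2) * w x ^ 2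
          - N * (4 * ((q : ℝ) + 1) * t ^ (2 * q + 1) * w x ^ 2) := by
        rw [← hnorm]
        simp only [Finset.sum_add_distrib, Finset.sum_sub_distrib, Finset.sum_const,
          Finset.card_univ, Fintype.card_fin, nsmul_eq_mul]
        rw [← Finset.mul_sum, ← Finset.mul_sum (f := fun j => partialDeriv j (partialDeriv j w) x),
          hwh.laplace x, ← Finset.sum_mul, ← Finset.mul_sum, mul_zero, add_zero]
      rw [hlhs] at h3
      rw [Finset.sum_add_distrib, ← Finset.mul_sum]
      have hbd : 16 * ((q : ℝ) + 1) ^ 2 * t ^ (2 * q) * (4 * ‖x - c‖ ^ 2) * w x ^ 2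
          + N * (4 * ((q : ℝ) + 1) * t ^ (2 * q + 1) * w x ^ 2)
          ≤ (64 * ((q : ℝ) + 1) * (N + q + 1) * r ^ 2) * (t ^ (2 * q) * w x ^ 2) := by
        have hA : 0 ≤ t ^ (2 * q) * w x ^ 2 := by positivity
        have e1 : 16 * ((q : ℝ) + 1) ^ 2 * t ^ (2 * q) * (4 * ‖x - c‖ ^ 2) * w x ^ 2
          + N * (4 * ((q : ℝ) + 1) * t ^ (2 * q + 1) * w x ^ 2)
          = (64 * ((q : ℝ) + 1) ^ 2 * ‖x - c‖ ^ 2 + 4 * N * ((q : ℝ) + 1) * t)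
            * (t ^ (2 * q) * w x ^ 2) := by ring
        rw [e1]
        refine mul_le_mul_of_nonneg_right ?_ hA
        have hn : ‖x - c‖ ^ 2 ≤ r ^ 2 := by linarith
        have b1 : 64 * ((q : ℝ) + 1) ^ 2 * ‖x - c‖ ^ 2 ≤ 64 * ((q : ℝ) + 1) ^ 2 * r ^ 2 := by
          gcongr
        have b2 : 4 * N * ((q : ℝ) + 1) * t ≤ 4 * N * ((q : ℝ) + 1) * r ^ 2 := by gcongr
        have b3 : 0 ≤ (N : ℝ) * ((q : ℝ) + 1) * r ^ 2 := by positivity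
        nlinarith
      have h4 : (bernsteinConst N r q)⁻¹ * t ^ (2 * q) * w x ^ 2 ≤ ∑ j, H j x := by
        refine le_trans ?_ h1
        have := bernsteinConst_pos N hr q
        gcongr
      rw [← hstep] at h4
      have h5 := mul_le_mul_of_nonneg_left h3 hapos.le
      have h6 := mul_le_mul_of_nonneg_left hbd hapos.le
      refine le_trans ?_ (add_le_add h4 h5)
      linarith

/-- The Bernstein function is subharmonic, so its value at the centre is at most its maximum on the
sphere, where it is just `u²`. -/
theorem abs_iterPartial_le {N : ℕ} (hN : 0 < N) {u : EuclideanSpace ℝ (Fin N) → ℝ}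
    (hu : SmoothHarmonic u) (c : EuclideanSpace ℝ (Fin N)) {r M : ℝ} (hr : 0 < r)
    (hM : ∀ x ∈ Metric.sphere c r, |u x| ≤ M) (L : List (Fin N)) :
    (r ^ 2) ^ (2 * L.length) * iterPartial L u c ^ 2 ≤ bernsteinConst N r L.length * M ^ 2 := by
  obtain ⟨Φ, G, H, hΦ, hcont, hsph, hcen, hsub⟩ := exists_bernstein hu c hr L
  have hpos := bernsteinConst_pos N hr L.length
  have h1 : Φ c ≤ M ^ 2 := by
    refine hΦ.le_of_subharmonic hN hcont hr (fun x hx => le_trans ?_ (hsub x hx)) fun x hx => ?_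
    · have h2 : 0 ≤ ∑ j, partialDeriv j (iterPartial L u) x ^ 2 :=
        Finset.sum_nonneg fun j _ => sq_nonneg _
      have h3 : 0 ≤ (r ^ 2 - ‖x - c‖ ^ 2) ^ (2 * L.length) := by
        rw [pow_mul]; positivity
      positivity
    · rw [hsph x hx, ← sq_abs]
      exact pow_le_pow_left₀ (abs_nonneg _) (hM x hx) 2
  have h2 := hcen.trans h1
  rw [mul_assoc, inv_mul_le_iff₀ hpos] at h2
  exact h2

theorem bernsteinConst_eq (N : ℕ) (r : ℝ) (q : ℕ) :
    bernsteinConst N r q = bernsteinConst N 1 q * (r ^ 2) ^ q := by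
  simp only [bernsteinConst, one_pow, mul_one]
  rw [← Finset.card_range q, ← Finset.prod_const, Finset.card_range, ← Finset.prod_mul_distrib]

/-- The Cauchy estimate for vector valued harmonic functions. -/
theorem norm_iterPartial_le {N : ℕ} (hN : 0 < N) {F : Type*} [NormedAddCommGroup F]
    [NormedSpace ℝ F] {u : EuclideanSpace ℝ (Fin N) → F} (hu : SmoothHarmonic u)
    (c : EuclideanSpace ℝ (Fin N)) {r M : ℝ} (hr : 0 < r) (hM0 : 0 ≤ M)
    (hM : ∀ x ∈ Metric.sphere c r, ‖u x‖ ≤ M) (L : List (Fin N)) :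
    ‖iterPartial L u c‖ ≤ √(bernsteinConst N 1 L.length) * M / r ^ L.length := by
  -- Testing against functionals reduces to real-valued functions, so the dimension of `F` does not
  -- enter the constant.
  refine NormedSpace.norm_le_dual_bound ℝ _ (by positivity) fun ℓ => ?_
  have h1 := abs_iterPartial_le hN (hu.clm_comp ℓ) c hr (M := ‖ℓ‖ * M) (fun x hx =>
    (ℓ.le_opNorm _).trans (mul_le_mul_of_nonneg_left (hM x hx) (norm_nonneg _))) L
  rw [iterPartial_clm_comp hu, bernsteinConst_eq] at h1
  set q := L.length
  have hB := bernsteinConst_pos N one_pos q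
  have hrq : 0 < r ^ q := by positivity
  have h2 : (r ^ q * ‖ℓ (iterPartial L u c)‖) ^ 2
      ≤ (√(bernsteinConst N 1 q) * (‖ℓ‖ * M)) ^ 2 := by
    rw [mul_pow, mul_pow √_, Real.sq_sqrt hB.le, Real.norm_eq_abs, sq_abs]
    have e1 : (r ^ 2) ^ (2 * q) = (r ^ 2) ^ q * (r ^ q) ^ 2 := by ring
    have e2 : (r ^ 2) ^ q = (r ^ q) ^ 2 := by ring
    rw [e1, e2] at h1
    have h3 : 0 < (r ^ q) ^ 2 := by positivity
    nlinarith [h1, h3]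
  have h4 := (sq_le_sq₀ (by positivity) (by positivity)).1 h2
  have e : √(bernsteinConst N 1 q) * M / r ^ q * ‖ℓ‖
      = √(bernsteinConst N 1 q) * (‖ℓ‖ * M) / r ^ q := by ring
  rw [e, le_div_iff₀ hrq, mul_comm]
  exact h4

/-- Factor by factor, `i + 1 ≤ n + i` and `n + i + 2 ≤ 3(n + i)` when `n ≥ 1`, so `64(i+1)(n+i+2) ≤
(16(n+i))²`. The product on the right is the numerator of `cauchyConst`. -/
theorem sqrt_bernsteinConst_le {n : ℕ} (hn : 0 < n) (q : ℕ) :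
    √(bernsteinConst (n + 1) 1 q) ≤ 16 ^ q * ∏ i ∈ Finset.range q, ((n : ℝ) + i) := by
  have e : (16 : ℝ) ^ q * ∏ i ∈ Finset.range q, ((n : ℝ) + i)
      = ∏ i ∈ Finset.range q, (16 * ((n : ℝ) + i)) := by
    rw [Finset.prod_mul_distrib, Finset.prod_const, Finset.card_range]
  rw [e]
  refine Real.sqrt_le_iff.2 ⟨Finset.prod_nonneg fun i _ => by positivity, ?_⟩
  rw [← Finset.prod_pow]
  refine Finset.prod_le_prod (fun i _ => by positivity) fun i _ => ?_
  have h1 : (1 : ℝ) ≤ n := by exact_mod_cast hn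
  have h2 : (0 : ℝ) ≤ i := by positivity
  push_cast
  nlinarith [mul_nonneg h2 (sub_nonneg.2 h1)]

/-! ### Locally uniform limits of harmonic functions -/

theorem norm_clm_le_sum {N : ℕ} {F : Type*} [NormedAddCommGroup F] [NormedSpace ℝ F]
    (A : EuclideanSpace ℝ (Fin N) →L[ℝ] F) :
    ‖A‖ ≤ ∑ j, ‖A (EuclideanSpace.single j 1)‖ := by
  refine A.opNorm_le_bound (Finset.sum_nonneg fun j _ => norm_nonneg _) fun x => ?_
  have hx : x = ∑ j, x j • EuclideanSpace.single j (1 : ℝ) := by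
    ext i
    simp [Pi.single_apply]
  conv_lhs => rw [hx]
  rw [map_sum, Finset.sum_mul]
  refine (norm_sum_le _ _).trans (Finset.sum_le_sum fun j _ => ?_)
  rw [map_smul, norm_smul, mul_comm]
  exact mul_le_mul_of_nonneg_left (PiLp.norm_apply_le x j) (norm_nonneg _)

theorem norm_fderiv_le {N : ℕ} (hN : 0 < N) {F : Type*} [NormedAddCommGroup F]
    [NormedSpace ℝ F] {u : EuclideanSpace ℝ (Fin N) → F} (hu : SmoothHarmonic u)
    (c : EuclideanSpace ℝ (Fin N)) {M : ℝ} (hM0 : 0 ≤ M)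
    (hM : ∀ x ∈ Metric.sphere c 1, ‖u x‖ ≤ M) :
    ‖fderiv ℝ u c‖ ≤ N * √(bernsteinConst N 1 1) * M := by
  refine (norm_clm_le_sum _).trans ?_
  have h : ∀ j ∈ (Finset.univ : Finset (Fin N)), ‖fderiv ℝ u c (EuclideanSpace.single j 1)‖
      ≤ √(bernsteinConst N 1 1) * M := by
    intro j _
    have := norm_iterPartial_le hN hu c one_pos hM0 hM [j]
    simp only [List.length_cons, List.length_nil, zero_add, pow_one, div_one] at this
    exact this
  refine (Finset.sum_le_sum h).trans ?_
  simp [mul_assoc]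

/-- The gradient estimate on unit spheres, applied to the differences `h k - h l`, turns locally
uniform convergence of the functions into that of their derivatives. -/
theorem contDiff_one_of_tendstoUniformlyOn {N : ℕ} (hN : 0 < N) {F : Type*}
    [NormedAddCommGroup F] [NormedSpace ℝ F] [CompleteSpace F]
    {h : ℕ → EuclideanSpace ℝ (Fin N) → F} {u : EuclideanSpace ℝ (Fin N) → F}
    (hh : ∀ k, SmoothHarmonic (h k))
    (hlim : ∀ R : ℝ, TendstoUniformlyOn h u atTop (Metric.closedBall 0 R)) :
    ContDiff ℝ 1 u ∧ ∀ x, Tendsto (fun k => fderiv ℝ (h k) x) atTop (𝓝 (fderiv ℝ u x)) := by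
  set K : ℝ := N * √(bernsteinConst N 1 1) with hK
  have hK0 : 0 ≤ K := by positivity
  have hcauchy : ∀ R : ℝ, UniformCauchySeqOn (fun k => fderiv ℝ (h k)) atTop (Metric.ball 0 R) := by
    intro R
    rw [Metric.uniformCauchySeqOn_iff]
    intro ε hε
    obtain ⟨k₀, hk₀⟩ := Metric.uniformCauchySeqOn_iff.1 (hlim (R + 1)).uniformCauchySeqOn
      (ε / (2 * (K + 1))) (by positivity)
    refine ⟨k₀, fun k hk l hl x hx => ?_⟩
    have h1 : fderiv ℝ (h k) x - fderiv ℝ (h l) x = fderiv ℝ (fun y => h k y - h l y) x :=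
      (fderiv_fun_sub ((hh k).differentiable x) ((hh l).differentiable x)).symm
    rw [dist_eq_norm, h1]
    refine (norm_fderiv_le hN ((hh k).sub (hh l)) x (M := ε / (2 * (K + 1))) (by positivity)
      fun y hy => ?_).trans_lt ?_
    · have hy' : y ∈ Metric.closedBall (0 : EuclideanSpace ℝ (Fin N)) (R + 1) := by
        rw [Metric.mem_closedBall]
        have := dist_triangle y x 0
        have h2 : dist y x = 1 := hy
        have h3 : dist x 0 < R := hx
        linarith
      have := hk₀ k hk l hl y hy'
      rw [dist_eq_norm] at this
      exact this.le
    · rw [← hK, ← mul_div_assoc, div_lt_iff₀ (by positivity)]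
      nlinarith [mul_nonneg hK0 hε.le]
  have hex : ∀ x, ∃ A, Tendsto (fun k => fderiv ℝ (h k) x) atTop (𝓝 A) := fun x =>
    cauchySeq_tendsto_of_complete ((hcauchy (‖x‖ + 1)).cauchySeq (by simp))
  choose g hg using hex
  have hunif : ∀ R : ℝ, TendstoUniformlyOn (fun k => fderiv ℝ (h k)) g atTop (Metric.ball 0 R) :=
    fun R => (hcauchy R).tendstoUniformlyOn_of_tendsto fun x _ => hg x
  have hder : ∀ x, HasFDerivAt u (g x) x := by
    intro x
    refine hasFDerivAt_of_tendstoUniformlyOn (s := Metric.ball 0 (‖x‖ + 1)) Metric.isOpen_ball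
      (hunif _) (fun k y _ => ((hh k).differentiable y).hasFDerivAt) (fun y hy => ?_) (by simp)
    exact (hlim (‖x‖ + 1)).tendsto_at (Metric.ball_subset_closedBall hy)
  have hcont : Continuous g := by
    rw [continuous_iff_continuousAt]
    intro x
    have h1 : ContinuousOn g (Metric.ball 0 (‖x‖ + 1)) :=
      (hunif _).continuousOn (Frequently.of_forall fun k =>
        (((hh k).contDiff 1).continuous_fderiv (by norm_num)).continuousOn)
    exact h1.continuousAt (Metric.isOpen_ball.mem_nhds (by simp))
  have hfd : fderiv ℝ u = g := funext fun x => (hder x).fderiv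
  refine ⟨contDiff_one_iff_fderiv.2 ⟨fun x => (hder x).differentiableAt, hfd ▸ hcont⟩, fun x => ?_⟩
  rw [hfd]
  exact hg x

/-! ### Mollification -/

open MeasureTheory Convolution in
/-- The mollification of `f` by the normed bump function `φ`. -/
def mollify {N : ℕ} {F : Type*} [NormedAddCommGroup F] [NormedSpace ℝ F]
    (φ : ContDiffBump (0 : EuclideanSpace ℝ (Fin N))) (f : EuclideanSpace ℝ (Fin N) → F) :
    EuclideanSpace ℝ (Fin N) → F :=
  φ.normed volume ⋆[ContinuousLinearMap.lsmul ℝ ℝ, volume] f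

section Mollify

open MeasureTheory Convolution

variable {N : ℕ} {F F' : Type*} [NormedAddCommGroup F] [NormedSpace ℝ F]
  [NormedAddCommGroup F'] [NormedSpace ℝ F']
  (φ : ContDiffBump (0 : EuclideanSpace ℝ (Fin N))) {f : EuclideanSpace ℝ (Fin N) → F}

theorem mollify_apply (f : EuclideanSpace ℝ (Fin N) → F) (x : EuclideanSpace ℝ (Fin N)) :
    mollify φ f x = ∫ t, φ.normed volume t • f (x - t) := rfl

theorem contDiff_mollify (hf : Continuous f) (k : ℕ) : ContDiff ℝ k (mollify φ f) :=
  φ.hasCompactSupport_normed.contDiff_convolution_left (n := k) _ φ.contDiff_normed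
    hf.locallyIntegrable

theorem integrable_mollify_integrand (hf : Continuous f) (x : EuclideanSpace ℝ (Fin N)) :
    Integrable (fun t => φ.normed volume t • f (x - t)) := by
  refine Continuous.integrable_of_hasCompactSupport ?_ ?_
  · have := φ.continuous_normed (μ := volume)
    fun_prop
  · exact φ.hasCompactSupport_normed.smul_right

theorem clm_mollify [CompleteSpace F] [CompleteSpace F'] (ℓ : F →L[ℝ] F') (hf : Continuous f)
    (x : EuclideanSpace ℝ (Fin N)) :
    ℓ (mollify φ f x) = mollify φ (fun y => ℓ (f y)) x := by
  rw [mollify_apply, mollify_apply, ← ℓ.integral_comp_comm (integrable_mollify_integrand φ hf x)]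
  simp

theorem hasFDerivAt_mollify [CompleteSpace F] (hf : ContDiff ℝ 1 f)
    (x : EuclideanSpace ℝ (Fin N)) :
    HasFDerivAt (mollify φ f) (mollify φ (fderiv ℝ f) x) x := by
  have hfc : Continuous (fderiv ℝ f) := hf.continuous_fderiv (by norm_num)
  have hd : Differentiable ℝ f := hf.differentiable (by norm_num)
  -- Domination for differentiating under the integral: the kernel lives in the ball of radius
  -- `φ.rOut`, so for `y` within distance `1` of `x` only values of `f'` in this compact ball
  -- matter.
  obtain ⟨B, hB⟩ := (isCompact_closedBall x (1 + φ.rOut)).exists_bound_of_continuousOn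
    hfc.continuousOn
  refine hasFDerivAt_integral_of_dominated_of_fderiv_le (μ := volume)
    (F := fun x t => φ.normed volume t • f (x - t))
    (F' := fun x t => φ.normed volume t • fderiv ℝ f (x - t))
    (bound := fun t => φ.normed volume t * B) (Metric.ball_mem_nhds x one_pos)
    (Eventually.of_forall fun y =>
      (integrable_mollify_integrand φ hf.continuous y).aestronglyMeasurable)
    (integrable_mollify_integrand φ hf.continuous x)
    (integrable_mollify_integrand φ hfc x).aestronglyMeasurable
    (Eventually.of_forall fun t y hy => ?_)
    (φ.integrable_normed.mul_const B) (Eventually.of_forall fun t y _ => ?_)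
  · rw [norm_smul, Real.norm_of_nonneg (φ.nonneg_normed t)]
    by_cases ht : t ∈ Function.support (φ.normed volume)
    · rw [φ.support_normed_eq] at ht
      refine mul_le_mul_of_nonneg_left (hB _ ?_) (φ.nonneg_normed t)
      rw [Metric.mem_closedBall, dist_eq_norm]
      have h1 : ‖y - x‖ < 1 := by rw [← dist_eq_norm]; exact hy
      have h2 : ‖t‖ < φ.rOut := by simpa using ht
      have e : y - t - x = (y - x) - t := by abel
      rw [e]
      exact (norm_sub_le _ _).trans (by linarith)
    · have : φ.normed volume t = 0 := by simpa using ht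
      simp [this]
  · have h1 : HasFDerivAt (fun z => f (z - t)) (fderiv ℝ f (y - t)) y := by
      have h2 := (hd (y - t)).hasFDerivAt.comp y ((hasFDerivAt_id y).sub_const t)
      simpa using! h2
    exact h1.const_smul _

theorem fderiv_mollify [CompleteSpace F] (hf : ContDiff ℝ 1 f) :
    fderiv ℝ (mollify φ f) = mollify φ (fderiv ℝ f) :=
  funext fun x => (hasFDerivAt_mollify φ hf x).fderiv

theorem partialDeriv_mollify [CompleteSpace F] (hf : ContDiff ℝ 1 f) (j : Fin N) :
    partialDeriv j (mollify φ f) = mollify φ (partialDeriv j f) := by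
  funext x
  have hfc : Continuous (fderiv ℝ f) := hf.continuous_fderiv (by norm_num)
  have := clm_mollify φ (ContinuousLinearMap.apply ℝ F (EuclideanSpace.single j (1 : ℝ))) hfc x
  simp only [ContinuousLinearMap.apply_apply] at this
  rw [partialDeriv, fderiv_mollify φ hf, this]
  rfl

theorem tendstoUniformlyOn_mollify [CompleteSpace F]
    {ψ : ℕ → ContDiffBump (0 : EuclideanSpace ℝ (Fin N))}
    (hψ : Tendsto (fun k => (ψ k).rOut) atTop (𝓝 0)) (hf : Continuous f) (R : ℝ) :
    TendstoUniformlyOn (fun k => mollify (ψ k) f) f atTop (Metric.closedBall 0 R) := by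
  rw [Metric.tendstoUniformlyOn_iff]
  intro ε hε
  have huc := (isCompact_closedBall (0 : EuclideanSpace ℝ (Fin N))
    (R + 1)).uniformContinuousOn_of_continuous hf.continuousOn
  obtain ⟨δ, hδ, hδ'⟩ := Metric.uniformContinuousOn_iff.1 huc (ε / 2) (half_pos hε)
  filter_upwards [hψ.eventually (gt_mem_nhds hδ), hψ.eventually (gt_mem_nhds one_pos)] with k h1 h2
    x hx
  rw [dist_comm]
  refine lt_of_le_of_lt ((ψ k).dist_normed_convolution_le (ε := ε / 2)
    hf.aestronglyMeasurable fun y hy => (hδ' y ?_ x ?_ ?_).le) (half_lt_self hε)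
  · rw [Metric.mem_closedBall] at hx ⊢
    have := dist_triangle y x 0
    have := Metric.mem_ball.1 hy
    linarith
  · exact Metric.closedBall_subset_closedBall (by linarith) hx
  · exact (Metric.mem_ball.1 hy).trans h1

theorem exists_bump_seq (N : ℕ) : ∃ ψ : ℕ → ContDiffBump (0 : EuclideanSpace ℝ (Fin N)),
    Tendsto (fun k => (ψ k).rOut) atTop (𝓝 0) := by
  refine ⟨fun k => ⟨1 / (k + 1) / 2, 1 / (k + 1), by positivity, ?_⟩, ?_⟩
  · have : (0 : ℝ) < 1 / (k + 1) := by positivity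
    linarith
  · exact tendsto_one_div_add_atTop_nhds_zero_nat

end Mollify

/-! ### Monogenic functions are smooth and harmonic -/

instance instFiniteDimensionalCl (n : ℕ) : FiniteDimensional ℝ (Cl n) :=
  Module.Basis.finiteDimensional_of_finite (eBasis n)

instance instCompleteSpaceCl (n : ℕ) : CompleteSpace (Cl n) := FiniteDimensional.complete ℝ _

/-- Left multiplication by `a` as a continuous linear map. -/
def mulLeftCLM {n : ℕ} (a : Cl n) : Cl n →L[ℝ] Cl n :=
  LinearMap.toContinuousLinearMap (LinearMap.mulLeft ℝ a)

theorem mulLeftCLM_apply {n : ℕ} (a b : Cl n) : mulLeftCLM a b = a * b := rfl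

/-- The symbol of the operator `𝒟`, so that `𝒟 f = diracSymbol (f')`. -/
def diracSymbol (n : ℕ) : (Pt n →L[ℝ] Cl n) →L[ℝ] Cl n :=
  ContinuousLinearMap.apply ℝ (Cl n) (EuclideanSpace.single 0 (1 : ℝ)) +
    ∑ i : Fin n, mulLeftCLM (e i) ∘L
      ContinuousLinearMap.apply ℝ (Cl n) (EuclideanSpace.single i.succ (1 : ℝ))

theorem dirac_eq {n : ℕ} (f : Pt n → Cl n) (x : Pt n) :
    dirac f x = diracSymbol n (fderiv ℝ f x) := by
  simp [dirac, diracSymbol, pderiv, mulLeftCLM_apply]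

theorem pderiv_eq_partialDeriv {n : ℕ} (j : Fin (n + 1)) (f : Pt n → Cl n) :
    pderiv j f = partialDeriv j f := rfl

theorem dirac_pderiv {n : ℕ} {f : Pt n → Cl n} (hf : ContDiff ℝ 2 f) (hD : ∀ x, dirac f x = 0)
    (j : Fin (n + 1)) (x : Pt n) : dirac (pderiv j f) x = 0 := by
  have hd : Differentiable ℝ (fderiv ℝ f) :=
    (hf.fderiv_right (m := 1) (by norm_num)).differentiable (by norm_num)
  have h1 : ∀ i : Fin (n + 1), Differentiable ℝ (partialDeriv i f) := fun i =>
    (contDiff_partialDeriv (k := 1) hf i).differentiable (by norm_num)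
  have h0 : partialDeriv j (fun y => diracSymbol n (fderiv ℝ f y)) x = 0 := by
    have : (fun y => diracSymbol n (fderiv ℝ f y)) = fun _ => 0 :=
      funext fun y => by rw [← dirac_eq, hD]
    rw [this]
    simp [partialDeriv]
  rw [← h0, partialDeriv]
  have h2 : HasFDerivAt (fun y => diracSymbol n (fderiv ℝ f y))
      (diracSymbol n ∘L fderiv ℝ (fderiv ℝ f) x) x :=
    (diracSymbol n).hasFDerivAt.comp x (hd x).hasFDerivAt
  rw [h2.fderiv, dirac_eq, ContinuousLinearMap.comp_apply]
  congr 1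
  ext v
  have h3 : fderiv ℝ (pderiv j f) x v
      = fderiv ℝ (fderiv ℝ f) x v (EuclideanSpace.single j 1) := by
    rw [pderiv_eq_partialDeriv]
    unfold partialDeriv
    rw [fderiv_clm_apply (hd x) (differentiableAt_const _)]
    simp
  rw [h3]
  exact (hf.contDiffAt.isSymmSndFDerivAt (by simp)).eq _ _

/-- The operator `𝒟` has constant coefficients, so it also annihilates every `∂_j f`. This trades
`∂_0² f` for `-∑ e_i ∂_0 ∂_i f` and then for `∑ e_i e_j ∂_i ∂_j f`, which equals `-∑ ∂_i² f`. -/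
theorem smoothHarmonic_of_dirac_eq_zero {n : ℕ} {f : Pt n → Cl n}
    (hf : ∀ k : ℕ, ContDiff ℝ k f) (hD : ∀ x, dirac f x = 0) : SmoothHarmonic f where
  contDiff := hf
  laplace x := by
    have h2 : ContDiff ℝ 2 f := hf 2
    set s : Fin n → Fin n → Cl n :=
      fun i j => partialDeriv i.succ (partialDeriv j.succ f) x with hs
    have hsymm : ∀ i j, s i j = s j i := fun i j =>
      congrFun (partialDeriv_comm h2 i.succ j.succ) x
    have h00 : partialDeriv 0 (partialDeriv 0 f) x
        = -∑ i : Fin n, e i * partialDeriv 0 (partialDeriv i.succ f) x := by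
      have := dirac_pderiv h2 hD 0 x
      rw [dirac, add_eq_zero_iff_eq_neg] at this
      simp only [pderiv_eq_partialDeriv, partialDeriv_comm h2 _ 0] at this
      exact this
    have h0 : ∀ i : Fin n, partialDeriv 0 (partialDeriv i.succ f) x
        = -∑ j : Fin n, e j * s i j := by
      intro i
      have := dirac_pderiv h2 hD i.succ x
      rw [dirac, add_eq_zero_iff_eq_neg] at this
      simp only [pderiv_eq_partialDeriv] at this
      rw [this]
      simp only [hs, fun j : Fin n => partialDeriv_comm h2 j.succ i.succ]
    -- Since `s` is symmetric, averaging with the transposed sum cancels the off-diagonal terms by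
    -- anticommutation and leaves `e_i² = -1` on the diagonal.
    have hS : ∑ i, ∑ j, (e i : Cl n) * e j * s i j = -∑ i, s i i := by
      set S := ∑ i, ∑ j, (e i : Cl n) * e j * s i j with hSdef
      have h3 : S = ∑ i, ∑ j, (e j : Cl n) * e i * s i j := by
        rw [hSdef, Finset.sum_comm]
        refine Finset.sum_congr rfl fun i _ => Finset.sum_congr rfl fun j _ => ?_
        rw [hsymm]
      have h4 : S + S = ∑ i, (-2 : ℝ) • s i i := by
        conv_lhs => rw [hSdef]; arg 2; rw [← hSdef, h3]
        rw [← Finset.sum_add_distrib]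
        refine Finset.sum_congr rfl fun i _ => ?_
        rw [← Finset.sum_add_distrib, Finset.sum_eq_single i]
        · rw [e_mul_self, neg_one_mul, neg_smul, two_smul, neg_add]
        · intro j _ hj
          rw [e_mul_e hj, neg_mul, add_neg_cancel]
        · simp
      rw [← Finset.smul_sum, ← two_smul ℝ, neg_smul, ← smul_neg] at h4
      exact smul_right_injective _ (two_ne_zero (α := ℝ)) h4
    rw [Fin.sum_univ_succ, h00]
    simp only [h0, mul_neg, Finset.sum_neg_distrib, neg_neg, Finset.mul_sum, ← mul_assoc]
    rw [hS]
    simp [hs]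

theorem dirac_mollify {n : ℕ} {f : Pt n → Cl n} (hf : IsMonogenic f)
    (φ : ContDiffBump (0 : Pt n)) (x : Pt n) : dirac (mollify φ f) x = 0 := by
  rw [dirac_eq, fderiv_mollify φ hf.1,
    clm_mollify φ (diracSymbol n) (hf.1.continuous_fderiv (by norm_num))]
  have : (fun y => diracSymbol n (fderiv ℝ f y)) = fun _ => 0 :=
    funext fun y => by rw [← dirac_eq, hf.2]
  rw [this, mollify_apply]
  simp

theorem smoothHarmonic_mollify {n : ℕ} {f : Pt n → Cl n} (hf : IsMonogenic f)
    (φ : ContDiffBump (0 : Pt n)) : SmoothHarmonic (mollify φ f) :=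
  smoothHarmonic_of_dirac_eq_zero (contDiff_mollify φ hf.1.continuous) (dirac_mollify hf φ)

/-- This gains one derivative. Mollifications of `f` are smooth and monogenic, and their partial
derivatives are the mollifications of `∂_j f`. These are harmonic and converge locally uniformly to
`∂_j f`, so the limit is `C¹` and the equation passes to it. -/
theorem IsMonogenic.pderiv {n : ℕ} {f : Pt n → Cl n} (hf : IsMonogenic f) (j : Fin (n + 1)) :
    IsMonogenic (pderiv j f) := by
  obtain ⟨ψ, hψ⟩ := exists_bump_seq (n + 1)
  have hc : Continuous (partialDeriv j f) :=
    (contDiff_partialDeriv (k := 0) hf.1 j).continuous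
  have hlim := tendstoUniformlyOn_mollify hψ hc
  have hsm : ∀ k, SmoothHarmonic (mollify (ψ k) (partialDeriv j f)) := fun k => by
    rw [← partialDeriv_mollify (ψ k) hf.1 j]
    exact (smoothHarmonic_mollify hf (ψ k)).partialDeriv j
  obtain ⟨h1, h2⟩ := contDiff_one_of_tendstoUniformlyOn n.succ_pos hsm hlim
  refine ⟨h1, fun x => ?_⟩
  rw [dirac_eq]
  have h3 := ((diracSymbol n).continuous.tendsto _).comp (h2 x)
  refine tendsto_nhds_unique h3 ?_
  refine tendsto_const_nhds.congr fun k => ?_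
  rw [Function.comp_apply, ← dirac_eq, ← partialDeriv_mollify (ψ k) hf.1 j]
  exact (dirac_pderiv ((smoothHarmonic_mollify hf (ψ k)).contDiff 2)
    (dirac_mollify hf (ψ k)) j x).symm

theorem IsMonogenic.contDiff {n : ℕ} {f : Pt n → Cl n} (hf : IsMonogenic f) (k : ℕ) :
    ContDiff ℝ k f := by
  induction k generalizing f with
  | zero => exact hf.1.of_le (by norm_num)
  | succ k ih =>
    push_cast
    rw [contDiff_succ_iff_fderiv_apply]
    refine ⟨hf.1.differentiable (by norm_num), by simp, fun y => ?_⟩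
    have h : (fun x => fderiv ℝ f x y) = fun x => ∑ j, y j • Monogenic.pderiv j f x := by
      funext x
      have hy : y = ∑ j, y j • EuclideanSpace.single j (1 : ℝ) := by
        ext i
        simp [Pi.single_apply]
      conv_lhs => rw [hy]
      simp [map_sum, Monogenic.pderiv]
    rw [h]
    exact ContDiff.sum fun j _ => (ih (hf.pderiv j)).const_smul _

theorem IsMonogenic.smoothHarmonic {n : ℕ} {f : Pt n → Cl n} (hf : IsMonogenic f) :
    SmoothHarmonic f :=
  smoothHarmonic_of_dirac_eq_zero hf.contDiff hf.2

theorem IsMonogenic.iterPartial {n : ℕ} {f : Pt n → Cl n} (hf : IsMonogenic f)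
    (L : List (Fin (n + 1))) : IsMonogenic (iterPartial L f) := by
  induction L with
  | nil => exact hf
  | cons j L ih => exact ih.pderiv j

/-- The Cauchy estimate depends only on the number of derivatives, so a multi-index may be flattened
to a list of directions. -/
theorem exists_mderiv_eq_iterPartial {n : ℕ} (m : Fin n → ℕ) (f : Pt n → Cl n) :
    ∃ L : List (Fin (n + 1)), L.length = mdeg m ∧ mderiv m f = iterPartial L f := by
  have h : ∀ l : List (Fin n), ∃ L : List (Fin (n + 1)), L.length = (l.map m).sum ∧
      l.foldr (fun i g => (pderiv i.succ)^[m i] g) f = iterPartial L f := by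
    intro l
    induction l with
    | nil => exact ⟨[], rfl, rfl⟩
    | cons i l ih =>
      obtain ⟨L, hL, hf⟩ := ih
      refine ⟨List.replicate (m i) i.succ ++ L, by simp [hL], ?_⟩
      rw [List.foldr_cons, hf]
      generalize m i = k
      induction k with
      | zero => rfl
      | succ k ih2 =>
        rw [Function.iterate_succ_apply', ih2]
        rfl
  obtain ⟨L, hL, hf⟩ := h (List.finRange n)
  refine ⟨L, ?_, hf⟩
  rw [hL, mdeg, Fin.sum_univ_def]

/-! ### The growth function of a normalized proximate order -/

/-- In logarithmic scale `x = log t`, the function `D x = log (t ^ p t) - ρ x` has derivative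
tending to `0`, by the two limits defining a proximate order. By the mean value inequality its
increments over a fixed step `log a` tend to `0`; exponentiating gives the claim. -/
theorem IsProximateOrder.tendsto_ratio {p : ℝ → ℝ} {ρ : ℝ} (hp : IsProximateOrder p ρ) {a : ℝ}
    (ha : 0 < a) :
    Tendsto (fun t => (a * t) ^ p (a * t) / t ^ p t) atTop (𝓝 (a ^ ρ)) := by
  set D : ℝ → ℝ := fun x => p (Real.exp x) * x - ρ * x with hD
  set D' : ℝ → ℝ := fun x => deriv p (Real.exp x) * Real.exp x * x + p (Real.exp x) - ρ with hD'
  have hder : ∀ x, HasDerivAt D (D' x) x := by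
    intro x
    have h1 : HasDerivAt p (deriv p (Real.exp x)) (Real.exp x) :=
      ((hp.differentiableOn _ (Real.exp_pos x).le).differentiableAt
        (Ici_mem_nhds (Real.exp_pos x))).hasDerivAt
    have h2 := ((h1.comp x (Real.hasDerivAt_exp x)).mul (hasDerivAt_id x)).sub
      ((hasDerivAt_id x).const_mul ρ)
    simp only [id_eq, mul_one] at h2
    exact h2
  have hlim : Tendsto D' atTop (𝓝 0) := by
    have h1 := hp.tendsto_deriv.comp Real.tendsto_exp_atTop
    have h2 := hp.tendsto.comp Real.tendsto_exp_atTop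
    have h3 := (h1.add h2).sub_const ρ
    simpa [Function.comp_def, Real.log_exp] using h3
  have hdiff : ∀ h : ℝ, Tendsto (fun x => D (x + h) - D x) atTop (𝓝 0) := by
    intro h
    rw [Metric.tendsto_atTop]
    intro ε hε
    obtain ⟨X, hX⟩ := Metric.tendsto_atTop.1 hlim (ε / (|h| + 1)) (by positivity)
    refine ⟨X + |h|, fun x hx => ?_⟩
    have hxm : x ∈ Ici X := by
      have := abs_nonneg h
      simp only [mem_Ici]; linarith
    have hxh : x + h ∈ Ici X := by
      have := neg_abs_le h
      simp only [mem_Ici]; linarith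
    have h1 := (convex_Ici X).norm_image_sub_le_of_norm_hasDerivWithin_le (f := D) (f' := D')
      (C := ε / (|h| + 1)) (fun y _ => (hder y).hasDerivWithinAt) (fun y hy => by
        have := hX y hy
        rw [dist_zero_right] at this
        exact this.le) hxm hxh
    rw [dist_zero_right]
    refine h1.trans_lt ?_
    rw [add_sub_cancel_left, Real.norm_eq_abs, div_mul_eq_mul_div, div_lt_iff₀ (by positivity)]
    nlinarith [abs_nonneg h]
  have h1 := (hdiff (Real.log a)).comp Real.tendsto_log_atTop
  have h2 : Tendsto (fun t => Real.exp (D (Real.log t + Real.log a) - D (Real.log t)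
      + ρ * Real.log a)) atTop (𝓝 (a ^ ρ)) := by
    have := (Real.continuous_exp.tendsto _).comp (h1.add_const (ρ * Real.log a))
    rw [zero_add] at this
    rw [Real.rpow_def_of_pos ha, mul_comm (Real.log a)]
    exact this
  refine h2.congr' ?_
  filter_upwards [eventually_gt_atTop 0] with t ht
  have hat : 0 < a * t := mul_pos ha ht
  rw [Real.rpow_def_of_pos hat, Real.rpow_def_of_pos ht, ← Real.exp_sub]
  congr 1
  have e : Real.log t + Real.log a = Real.log (a * t) := by
    rw [Real.log_mul ha.ne' ht.ne', add_comm]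
  simp only [hD, e, Real.exp_log hat, Real.exp_log ht]
  rw [← e]
  ring

namespace IsNormalizedProximateOrder

variable {p : ℝ → ℝ} {ρ : ℝ}

/-- If `p 0 = 0`, differentiability at `0` gives `p t = O(t)`, so `t ^ p t → 1` as `t → 0⁺`; but the
increasing surjection onto `(0, ∞)` takes the value `1/2`. This is needed because `0 ^ 0 = 1` would
break monotonicity at the origin. -/
theorem map_zero_ne_zero (hp : IsNormalizedProximateOrder p ρ) : p 0 ≠ 0 := by
  intro h0
  have hO : (fun t => p t) =O[𝓝[>] 0] fun t : ℝ => t := by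
    have h1 := (hp.differentiableOn 0 self_mem_Ici).isBigO_sub
    simp only [h0, sub_zero] at h1
    exact h1.mono (nhdsWithin_mono 0 Ioi_subset_Ici_self)
  have h2 : Tendsto (fun t => Real.log t * p t) (𝓝[>] 0) (𝓝 0) := by
    have h3 : (fun t => Real.log t * p t) =O[𝓝[>] 0] fun t => Real.log t * t :=
      (Asymptotics.isBigO_refl _ _).mul hO
    refine h3.trans_tendsto ?_
    simpa using tendsto_log_mul_rpow_nhdsGT_zero one_pos
  have h4 : Tendsto (fun t : ℝ => t ^ p t) (𝓝[>] 0) (𝓝 1) := by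
    have h5 := (Real.continuous_exp.tendsto 0).comp h2
    rw [Real.exp_zero] at h5
    refine h5.congr' ?_
    filter_upwards [self_mem_nhdsWithin] with t ht
    exact (Real.rpow_def_of_pos ht _).symm
  obtain ⟨t₀, ht₀, hval⟩ := hp.bijOn.surjOn (show (1 / 2 : ℝ) ∈ Ioi 0 by norm_num)
  have h6 : ∀ᶠ t : ℝ in 𝓝[>] 0, t ^ p t ≤ 1 / 2 := by
    filter_upwards [Ioo_mem_nhdsGT ht₀] with t ht
    rw [← hval]
    exact (hp.strictMonoOn ht.1 ht₀ ht.2).le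
  have := le_of_tendsto h4 h6
  norm_num at this

theorem rpow_mono (hp : IsNormalizedProximateOrder p ρ) {s t : ℝ} (hs : 0 ≤ s) (hst : s ≤ t) :
    s ^ p s ≤ t ^ p t := by
  rcases hs.eq_or_lt with rfl | hs
  · rw [Real.zero_rpow hp.map_zero_ne_zero]
    exact Real.rpow_nonneg hst _
  · exact hp.strictMonoOn.monotoneOn hs (hs.trans_le hst) hst

theorem phi_pos (hp : IsNormalizedProximateOrder p ρ) {y : ℝ} (hy : 0 < y) : 0 < phi p y :=
  Function.invFunOn_mem (hp.bijOn.surjOn hy)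

theorem rpow_phi (hp : IsNormalizedProximateOrder p ρ) {y : ℝ} (hy : 0 < y) :
    phi p y ^ p (phi p y) = y :=
  Function.invFunOn_eq (hp.bijOn.surjOn hy)

/-- The ratio for the dilation by `2` tends to `2^ρ < 2^(ρ+1)`, which settles large `t`; on the
remaining bounded interval monotonicity gives the constant. -/
theorem exists_doubling (hp : IsNormalizedProximateOrder p ρ) :
    ∃ C, 0 ≤ C ∧ ∀ t, 0 ≤ t → (2 * t) ^ p (2 * t) ≤ 2 ^ (ρ + 1) * t ^ p t + C := by
  have hlt : (2 : ℝ) ^ ρ < 2 ^ (ρ + 1) :=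
    Real.rpow_lt_rpow_of_exponent_lt (by norm_num) (by linarith)
  obtain ⟨T, hT⟩ := eventually_atTop.1
    ((hp.toIsProximateOrder.tendsto_ratio two_pos).eventually (gt_mem_nhds hlt))
  set T' := max T 1
  have hT0 : 0 < T' := lt_max_of_lt_right one_pos
  refine ⟨(2 * T') ^ p (2 * T'), by positivity, fun t ht => ?_⟩
  rcases le_total t T' with h | h
  · have h1 := hp.rpow_mono (s := 2 * t) (t := 2 * T') (by positivity) (by linarith)
    have h2 : 0 ≤ 2 ^ (ρ + 1) * t ^ p t := by positivity
    linarith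
  · have h1 := hT t ((le_max_left _ _).trans h)
    have ht0 : 0 < t := hT0.trans_le h
    rw [div_lt_iff₀ (by positivity)] at h1
    have h2 : 0 ≤ (2 * T') ^ p (2 * T') := by positivity
    linarith

theorem exists_quasi_subadditive (hp : IsNormalizedProximateOrder p ρ) :
    ∃ C, 0 ≤ C ∧ ∀ s t, 0 ≤ s → 0 ≤ t →
      (s + t) ^ p (s + t) ≤ 2 ^ (ρ + 1) * (s ^ p s + t ^ p t) + C := by
  obtain ⟨C, hC, h⟩ := hp.exists_doubling
  refine ⟨C, hC, fun s t hs ht => ?_⟩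
  have h1 : (s + t) ^ p (s + t) ≤ (2 * max s t) ^ p (2 * max s t) :=
    hp.rpow_mono (by positivity) (by linarith [le_max_left s t, le_max_right s t])
  have h2 := h (max s t) (hs.trans (le_max_left _ _))
  have h3 : max s t ^ p (max s t) ≤ s ^ p s + t ^ p t := by
    have := Real.rpow_nonneg hs (p s)
    have := Real.rpow_nonneg ht (p t)
    rcases max_choice s t with h | h <;> rw [h] <;> linarith
  have h4 : (2 : ℝ) ^ (ρ + 1) * max s t ^ p (max s t) ≤ 2 ^ (ρ + 1) * (s ^ p s + t ^ p t) := by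
    gcongr
  linarith

/-- With `a = 2 σ^(1/ρ)` one has `a^ρ = 2^ρ σ > σ`. Hence, for large `y`, dilating `φ(y/σ)` by `a`
multiplies the growth function by more than `σ`, and lifts it from `y/σ` above `y`. The factor `2`
only provides strictness. -/
theorem eventually_phi_le (hp : IsNormalizedProximateOrder p ρ) (hρ : 0 < ρ) {σ : ℝ}
    (hσ : 0 < σ) :
    ∀ᶠ y in atTop, phi p y ≤ 2 * σ ^ (1 / ρ) * phi p (y / σ) := by
  set a := 2 * σ ^ (1 / ρ) with ha
  have ha0 : 0 < a := by positivity
  have hlt : σ < a ^ ρ := by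
    rw [ha, Real.mul_rpow (by norm_num) (by positivity), ← Real.rpow_mul hσ.le,
      one_div_mul_cancel hρ.ne', Real.rpow_one]
    have : (1 : ℝ) < 2 ^ ρ := Real.one_lt_rpow (by norm_num) hρ
    nlinarith
  obtain ⟨T, hT⟩ := eventually_atTop.1
    ((hp.toIsProximateOrder.tendsto_ratio ha0).eventually (lt_mem_nhds hlt))
  set T' := max T 1
  have hT0 : 0 < T' := lt_max_of_lt_right one_pos
  filter_upwards [eventually_gt_atTop 0, eventually_gt_atTop (σ * T' ^ p T')] with y hy hyT
  have hyσ : 0 < y / σ := div_pos hy hσ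
  have hb := hp.phi_pos hyσ
  have hTb : T' ≤ phi p (y / σ) := by
    by_contra! hlt
    have h1 := hp.rpow_mono hb.le hlt.le
    rw [hp.rpow_phi hyσ, div_le_iff₀ hσ] at h1
    linarith
  have h2 := hT _ ((le_max_left _ _).trans hTb)
  rw [lt_div_iff₀ (by positivity), hp.rpow_phi hyσ, mul_div_cancel₀ _ hσ.ne'] at h2
  by_contra! hlt
  have h3 := hp.rpow_mono (by positivity) hlt.le
  rw [hp.rpow_phi hy] at h3
  linarith

theorem exists_phi_pow_le (hp : IsNormalizedProximateOrder p ρ) (hρ : 0 < ρ) {σ : ℝ}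
    (hσ : 0 < σ) :
    ∃ C, 1 ≤ C ∧ ∀ q : ℕ, 0 < q →
      phi p q ^ q ≤ C * (2 * σ ^ (1 / ρ) * phi p (q / σ)) ^ q := by
  obtain ⟨Y, hY⟩ := eventually_atTop.1
    (tendsto_natCast_atTop_atTop.eventually (hp.eventually_phi_le hρ hσ))
  -- The finitely many `q` below the threshold are absorbed by summing their ratios into the
  -- constant.
  set b : ℕ → ℝ := fun q => |phi p q ^ q / (2 * σ ^ (1 / ρ) * phi p (q / σ)) ^ q| with hb
  have hsum : 0 ≤ ∑ q ∈ Finset.range Y, b q := Finset.sum_nonneg fun _ _ => abs_nonneg _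
  refine ⟨1 + ∑ q ∈ Finset.range Y, b q, by linarith, fun q hq => ?_⟩
  have hq0 : (0 : ℝ) < q := by exact_mod_cast hq
  have h1 := hp.phi_pos (div_pos hq0 hσ)
  have h2 := hp.phi_pos hq0
  have hpos : 0 < (2 * σ ^ (1 / ρ) * phi p (q / σ)) ^ q := by positivity
  rcases le_or_gt Y q with h | h
  · have h3 : phi p q ^ q ≤ (2 * σ ^ (1 / ρ) * phi p (q / σ)) ^ q :=
      pow_le_pow_left₀ h2.le (hY q h) q
    nlinarith [mul_nonneg hsum hpos.le]
  · have h3 : b q ≤ ∑ q ∈ Finset.range Y, b q :=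
      Finset.single_le_sum (fun _ _ => abs_nonneg _) (Finset.mem_range.2 h)
    have h4 := (le_abs_self _).trans h3
    rw [div_le_iff₀ hpos] at h4
    nlinarith

end IsNormalizedProximateOrder

/-! ### The weighted norms -/

theorem norm_le_wnorm {n : ℕ} {p : ℝ → ℝ} {σ : ℝ} {f : Pt n → Cl n}
    (hf : BddAbove (range (weighted p σ f))) (x : Pt n) :
    ‖f x‖ ≤ wnorm p σ f * Real.exp (σ * ‖x‖ ^ p ‖x‖) := by
  have h1 : weighted p σ f x ≤ wnorm p σ f := le_ciSup hf x
  rw [weighted, neg_mul, Real.exp_neg, ← div_eq_mul_inv, div_le_iff₀ (Real.exp_pos _)] at h1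
  exact h1

theorem wnorm_nonneg {n : ℕ} (p : ℝ → ℝ) (σ : ℝ) (f : Pt n → Cl n) : 0 ≤ wnorm p σ f :=
  Real.iSup_nonneg fun _ => mul_nonneg (norm_nonneg _) (Real.exp_pos _).le

theorem wnorm_le_of_forall {n : ℕ} {p : ℝ → ℝ} {σ B : ℝ} {f : Pt n → Cl n}
    (h : ∀ x, weighted p σ f x ≤ B) :
    BddAbove (range (weighted p σ f)) ∧ wnorm p σ f ≤ B :=
  ⟨⟨B, by rintro _ ⟨x, rfl⟩; exact h x⟩, ciSup_le h⟩

/-- The Cauchy estimate with the radius `r` in the weighted norms. -/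
theorem weighted_iterPartial_le {n : ℕ} {p : ℝ → ℝ} {ρ σ k C : ℝ}
    (hp : IsNormalizedProximateOrder p ρ) (hσ : 0 < σ) (hk : 2 ^ (ρ + 1) ≤ k)
    (hC : ∀ s t, 0 ≤ s → 0 ≤ t → (s + t) ^ p (s + t) ≤ 2 ^ (ρ + 1) * (s ^ p s + t ^ p t) + C)
    {f : Pt n → Cl n} (hf : f ∈ growthSpace n p σ) (L : List (Fin (n + 1))) {r : ℝ} (hr : 0 < r)
    (x : Pt n) :
    weighted p (k * σ) (iterPartial L f) x ≤ √(bernsteinConst (n + 1) 1 L.length) *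
      (wnorm p σ f * Real.exp (σ * (2 ^ (ρ + 1) * r ^ p r + C))) / r ^ L.length := by
  have hw := wnorm_nonneg p σ f
  have h1 := norm_iterPartial_le n.succ_pos hf.1.smoothHarmonic x hr
    (M := wnorm p σ f * Real.exp (σ * (‖x‖ + r) ^ p (‖x‖ + r))) (by positivity) (fun y hy => by
      refine (norm_le_wnorm hf.2 y).trans ?_
      have hyx : ‖y‖ ≤ ‖x‖ + r := by
        have h2 : ‖y - x‖ = r := by rw [← dist_eq_norm]; exact hy
        have h3 := norm_add_le x (y - x)
        rwa [add_sub_cancel, h2] at h3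
      have h4 := hp.rpow_mono (norm_nonneg y) hyx
      gcongr) L
  -- Quasi-subadditivity splits the exponent into a part in `‖x‖`, cancelled by the heavier weight
  -- because `k ≥ 2^(ρ+1)`, and a part in `r` independent of `x`.
  have h5 : Real.exp (σ * (‖x‖ + r) ^ p (‖x‖ + r)) * Real.exp (-(k * σ) * ‖x‖ ^ p ‖x‖)
      ≤ Real.exp (σ * (2 ^ (ρ + 1) * r ^ p r + C)) := by
    rw [← Real.exp_add]
    refine Real.exp_le_exp.2 ?_
    have h6 := mul_le_mul_of_nonneg_left (hC ‖x‖ r (norm_nonneg _) hr.le) hσ.le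
    have h7 : 2 ^ (ρ + 1) * ‖x‖ ^ p ‖x‖ ≤ k * ‖x‖ ^ p ‖x‖ := by gcongr
    have h8 := mul_le_mul_of_nonneg_left h7 hσ.le
    linarith
  refine (mul_le_mul_of_nonneg_right h1 (Real.exp_pos _).le).trans ?_
  have e : √(bernsteinConst (n + 1) 1 L.length) *
      (wnorm p σ f * Real.exp (σ * (‖x‖ + r) ^ p (‖x‖ + r))) / r ^ L.length *
        Real.exp (-(k * σ) * ‖x‖ ^ p ‖x‖)
      = √(bernsteinConst (n + 1) 1 L.length) * (wnorm p σ f *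
        (Real.exp (σ * (‖x‖ + r) ^ p (‖x‖ + r)) * Real.exp (-(k * σ) * ‖x‖ ^ p ‖x‖)))
          / r ^ L.length := by ring
  rw [e]
  gcongr

theorem weighted_le_weighted {n : ℕ} {p : ℝ → ℝ} {σ k : ℝ} (hσ : 0 < σ) (hk : 1 ≤ k)
    (f : Pt n → Cl n) (x : Pt n) : weighted p (k * σ) f x ≤ weighted p σ f x := by
  refine mul_le_mul_of_nonneg_left (Real.exp_le_exp.2 ?_) (norm_nonneg _)
  have h1 : 0 ≤ ‖x‖ ^ p ‖x‖ := by positivity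
  nlinarith [mul_nonneg hσ.le h1, mul_nonneg (sub_nonneg.2 hk) (mul_nonneg hσ.le h1)]

/-- For `q > 0` the exponents `ρ/q` and `q/ρ` cancel on `c`, and the factor `(eρ)^(q/ρ)` from `G`
joins `2k` in the numerator, so the target becomes `c` times a geometric term over `φ(q)^q`. -/
theorem bound_eq {p : ℝ → ℝ} {ρ k c σ : ℝ} (hρ : 0 < ρ) (hk : 0 ≤ k) (hc : 0 ≤ c) (hσ : 0 ≤ σ)
    {q : ℕ} (hq : 0 < q) :
    (2 * k * c ^ (ρ / (q : ℝ)) * σ) ^ ((q : ℝ) / ρ) / G p ρ q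
      = c * ((2 * k * (Real.exp 1 * ρ)) ^ (1 / ρ) * σ ^ (1 / ρ)) ^ q / phi p q ^ q := by
  have hq0 : (0 : ℝ) < q := by exact_mod_cast hq
  have he : 0 ≤ Real.exp 1 * ρ := by positivity
  have h1 : (c ^ (ρ / (q : ℝ))) ^ ((q : ℝ) / ρ) = c := by
    rw [← Real.rpow_mul hc, div_mul_div_cancel₀ hq0.ne', div_self hρ.ne', Real.rpow_one]
  have h2 : ∀ a : ℝ, 0 ≤ a → (a ^ (1 / ρ)) ^ q = a ^ ((q : ℝ) / ρ) := fun a ha => by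
    rw [← Real.rpow_natCast, ← Real.rpow_mul ha, one_div_mul_eq_div]
  rw [G, mul_pow, h2 _ (by positivity), h2 _ hσ, Real.mul_rpow (by positivity) hσ,
    Real.mul_rpow (by positivity) (by positivity), h1,
    Real.mul_rpow (by positivity) he, div_div_eq_mul_div]
  ring

end Monogenic

end

/-! ### The lemma: choice of constants and of the radius -/

open Monogenic in
theorem lemma3 (ρ : ℝ) (hρ : 0 < ρ) :
    ∃ k : ℝ, 0 < k ∧
      ∀ p : ℝ → ℝ, Monogenic.IsNormalizedProximateOrder p ρ →
      ∀ σ : ℝ, 0 < σ →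
      ∃ C : ℝ, 0 < C ∧
        ∀ n : ℕ, ∀ f ∈ Monogenic.growthSpace n p σ, ∀ m : Fin n → ℕ, ∀ q : ℕ, q = Monogenic.mdeg m →
          Monogenic.mderiv m f ∈ Monogenic.growthSpace n p (k * σ) ∧
          1 / (Monogenic.mfact m : ℝ) * Monogenic.wnorm p (k * σ) (Monogenic.mderiv m f) ≤
            C * Monogenic.wnorm p σ f *
              ((2 * k * Monogenic.cauchyConst n m ^ (ρ / (q : ℝ)) * σ) ^ ((q : ℝ) / ρ) /
                Monogenic.G p ρ q) := by
  set κ : ℝ := 2 ^ (ρ + 1) with hκ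
  have hκ1 : 1 ≤ κ := Real.one_le_rpow (by norm_num) (by linarith)
  -- The first entry lets the weight absorb the growth in `‖x‖`. The second makes `(2k e ρ)^(1/ρ) ≥
  -- 32 e^κ`, where `32 = 16 · 2` collects the Cauchy estimate and the comparison of `φ(q)` with
  -- `φ(q/σ)`, and `e^κ` comes from the radius.
  set k : ℝ := max κ ((32 * Real.exp κ) ^ ρ / (2 * (Real.exp 1 * ρ))) with hk
  have hkκ : κ ≤ k := le_max_left _ _
  have hk0 : 0 < k := by linarith
  have hkexp : 32 * Real.exp κ ≤ (2 * k * (Real.exp 1 * ρ)) ^ (1 / ρ) := by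
    have h1 : (32 * Real.exp κ) ^ ρ ≤ 2 * k * (Real.exp 1 * ρ) := by
      have h2 : (32 * Real.exp κ) ^ ρ / (2 * (Real.exp 1 * ρ)) ≤ k := le_max_right _ _
      rw [div_le_iff₀ (by positivity)] at h2
      linarith
    have h3 := Real.rpow_le_rpow (by positivity) h1 (z := 1 / ρ) (by positivity)
    rwa [← Real.rpow_mul (by positivity), mul_one_div_cancel hρ.ne', Real.rpow_one] at h3
  refine ⟨k, hk0, fun p hp σ hσ => ?_⟩
  obtain ⟨C₁, hC₁, hsub⟩ := hp.exists_quasi_subadditive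
  obtain ⟨C₂, hC₂, hphi⟩ := hp.exists_phi_pow_le hρ hσ
  have hexp1 : 1 ≤ Real.exp (σ * C₁) := Real.one_le_exp (by positivity)
  refine ⟨Real.exp (σ * C₁) * C₂, by positivity, fun n f hf m q hq => ?_⟩
  have hw := wnorm_nonneg p σ f
  obtain ⟨L, hL, hfL⟩ := exists_mderiv_eq_iterPartial m f
  rw [← hq] at hL
  rw [hfL]
  have hmon := hf.1.iterPartial L
  have hfact1 : (1 : ℝ) ≤ mfact m := by
    have : 0 < mfact m := Finset.prod_pos fun i _ => Nat.factorial_pos _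
    exact_mod_cast this
  rcases Nat.eq_zero_or_pos q with h0 | hqpos
  · subst h0
    have hnil : L = [] := List.length_eq_zero_iff.1 hL
    subst hnil
    obtain ⟨h1, h2⟩ := wnorm_le_of_forall (B := wnorm p σ f) fun x =>
      (weighted_le_weighted hσ (hκ1.trans hkκ) f x).trans (le_ciSup hf.2 x)
    refine ⟨⟨hmon, h1⟩, ?_⟩
    have h3 : 1 / (mfact m : ℝ) * wnorm p (k * σ) f ≤ 1 * wnorm p σ f :=
      mul_le_mul (by rw [div_le_one (by linarith)]; exact hfact1) h2 (wnorm_nonneg _ _ _) one_pos.le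
    have h4 : 1 ≤ Real.exp (σ * C₁) * C₂ := one_le_mul_of_one_le_of_one_le hexp1 hC₂
    have h5 : 1 * wnorm p σ f ≤ Real.exp (σ * C₁) * C₂ * wnorm p σ f := by gcongr
    -- For `q = 0` the exponent `q/ρ` is `0` and `G` is `1`, so the fraction is `1` whatever `phi p
    -- 0` is.
    simpa [G, iterPartial] using h3.trans h5
  · have hq0 : (0 : ℝ) < q := by exact_mod_cast hqpos
    -- A multi-index of positive degree forces `n ≥ 1`, as the bound on `bernsteinConst` requires.
    have hn : 0 < n := by
      rcases Nat.eq_zero_or_pos n with rfl | h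
      · simp [mdeg] at hq; omega
      · exact h
    -- The radius is `r = φ(q/σ)`, so that `σ r^(p r) = q` and the exponential loss is `e^(κq)` up
    -- to the constant `exp(σ C₁)`.
    have hqσ : 0 < q / σ := div_pos hq0 hσ
    have hr := hp.phi_pos hqσ
    have hφ := hp.phi_pos hq0
    obtain ⟨h1, h2⟩ := wnorm_le_of_forall fun x =>
      weighted_iterPartial_le hp hσ hkκ hsub hf L hr x
    refine ⟨⟨hmon, h1⟩, ?_⟩
    rw [hL, hp.rpow_phi hqσ] at h2
    set r := phi p (q / σ) with hrdef
    have hc : 0 ≤ cauchyConst n m :=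
      div_nonneg (Finset.prod_nonneg fun i _ => by positivity) (by linarith)
    rw [bound_eq hρ hk0.le hc hσ.le hqpos]
    have hsqrt : 1 / (mfact m : ℝ) * √(bernsteinConst (n + 1) 1 q)
        ≤ 16 ^ q * cauchyConst n m := by
      have h3 := sqrt_bernsteinConst_le hn q
      have e : 16 ^ q * cauchyConst n m
          = 1 / (mfact m : ℝ) * (16 ^ q * ∏ i ∈ Finset.range q, ((n : ℝ) + i)) := by
        rw [cauchyConst, ← hq]; ring
      rw [e]
      gcongr
    have hexp : Real.exp (σ * (κ * (q / σ) + C₁)) = Real.exp κ ^ q * Real.exp (σ * C₁) := by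
      rw [← Real.exp_nat_mul, ← Real.exp_add]
      congr 1
      field_simp
    have hrad : 1 / r ^ q ≤ C₂ * (2 * σ ^ (1 / ρ)) ^ q / phi p q ^ q := by
      rw [div_le_div_iff₀ (by positivity) (by positivity), one_mul]
      have := hphi q hqpos
      rw [mul_pow] at this
      linarith
    calc 1 / (mfact m : ℝ) * wnorm p (k * σ) (iterPartial L f)
        ≤ 1 / (mfact m : ℝ) * (√(bernsteinConst (n + 1) 1 q) *
            (wnorm p σ f * Real.exp (σ * (κ * (q / σ) + C₁))) / r ^ q) := by gcongr
      _ = (1 / (mfact m : ℝ) * √(bernsteinConst (n + 1) 1 q)) *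
            (wnorm p σ f * (Real.exp κ ^ q * Real.exp (σ * C₁))) * (1 / r ^ q) := by
          rw [hexp]; ring
      _ ≤ (16 ^ q * cauchyConst n m) * (wnorm p σ f * (Real.exp κ ^ q * Real.exp (σ * C₁))) *
            (C₂ * (2 * σ ^ (1 / ρ)) ^ q / phi p q ^ q) := by gcongr
      _ = Real.exp (σ * C₁) * C₂ * wnorm p σ f *
            (cauchyConst n m * ((32 * Real.exp κ) * σ ^ (1 / ρ)) ^ q / phi p q ^ q) := by
          have e : (32 : ℝ) ^ q = 16 ^ q * 2 ^ q := by rw [← mul_pow]; norm_num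
          rw [mul_pow, mul_pow, mul_pow, e]
          ring
      _ ≤ Real.exp (σ * C₁) * C₂ * wnorm p σ f *
            (cauchyConst n m * ((2 * k * (Real.exp 1 * ρ)) ^ (1 / ρ) * σ ^ (1 / ρ)) ^ q
              / phi p q ^ q) := by gcongr
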